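/- Let $K$ be a field, $S=K[x_1,\ldots,x_n]$ with the standard grading, and $A=K[x_1,\ldots,x_n,y_1,\ldots,y_m]$ with the bigrading $\deg x_i=(1,0)$, $\deg y_t=(p_t,1)$, where $p_t\ge 0$ are integers. For a finitely generated bigraded $A$-module $M=\bigoplus_{(i,k)\in\mathbb Z^2}M_{(i,k)}$ let $M_k=\bigoplus_i M_{(i,k)}$, a finitely generated graded $S$-module, let $\mathfrak m=(x_1,\ldots,x_n)$, and let $\operatorname{ldim}M=\lim_{k\to\infty}\dim M_k$, where $\dim$ is Krull dimension and $\dim 0=-\infty$. For a finitely generated graded $S$-module $N$ put $H_0(N,x)=\dim_K N_x$ and $H_i(N,x)=\sum_{y\le x}H_{i-1}(N,y)$ for $i\geq 1$, and let $P^i_N\in\mathbb Q[x]$ be the polynomial with $H_i(N,x)=P^i_N(x)$ for all $x\gg0$. With $d=\dim N$, the higher iterated Hilbert coefficients $e^i_j(N)$ ($i,j\ge 0$) are the integers determined by $$P^i_N(x)=\sum_{j=0}^{d+i-1}(-1)^j e^i_j(N)\binom{x+d+i-j-1}{d+i-j-1},$$ with $e^i_j(N)=0$ for $j>d+i-1$;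 if $N=0$, all $e^i_j(N)$ are $0$. **Theorem.** Assume $p_1=\cdots=p_m=p$ and let $M$ be a finitely generated bigraded $A$-module. Then the limit $\operatorname{ldim}M$ exists, the sequence $\dim M_k$ being constant for $k\gg0$, and there is an integer $k_0$ such that for all $i,j\ge 0$ there is a polynomial $q^i_j\in\mathbb Q[x]$ with $e^i_j(M_k)=q^i_j(k)$ for all $k\ge k_0$. Moreover $$\deg q^i_j\le \dim M/\mathfrak mM+j-1\qquad\text{for } 0\le j\le \operatorname{ldim}M+i-1,$$ and $e^i_j(M_k)=0$ for all $k\ge k_0$ if $j>\operatorname{ldim}M+i-1$. (The zero polynomial is regarded as satisfying every degree bound.) -/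

import Mathlib

open Polynomial Filter

noncomputable section

namespace BigradedHilbert

universe u v

/-! ### Polynomial rings and their gradings -/

/-- The polynomial ring `S = K[x₁, …, xₙ]`. -/
abbrev PolyX (K : Type u) [Field K] (n : ℕ) : Type u := MvPolynomial (Fin n) K

/-- The polynomial ring `A = K[x₁, …, xₙ, y₁, …, yₘ]`. -/
abbrev PolyXY (K : Type u) [Field K] (n m : ℕ) : Type u := MvPolynomial (Fin n ⊕ Fin m) K

/-- The bidegrees of the variables: `deg xᵢ = (1, 0)` and `deg yⱼ = (pⱼ, 1)`. -/
def bidegree (n : ℕ) {m : ℕ} (p : Fin m → ℕ) : Fin n ⊕ Fin m → ℤ × ℤ :=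
  Sum.elim (fun _ => (1, 0)) (fun j => ((p j : ℤ), 1))

/-- The bigrading of `A`: the component of bidegree `c` is spanned by the monomials of
bidegree `c`. -/
def bigrading (K : Type u) [Field K] (n : ℕ) {m : ℕ} (p : Fin m → ℕ) (c : ℤ × ℤ) :
    Submodule K (PolyXY K n m) :=
  MvPolynomial.weightedHomogeneousSubmodule K (bidegree n p) c

/-- The inclusion of `S` into `A`. -/
def inclX (K : Type u) [Field K] (n m : ℕ) : PolyX K n →ₐ[K] PolyXY K n m :=
  MvPolynomial.rename Sum.inl

/-- The ideal `(x₁, …, xₙ)` of `A`, which is the extension of the maximal ideal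
`(x₁, …, xₙ)` of `S`. -/
def idealX (K : Type u) [Field K] (n m : ℕ) : Ideal (PolyXY K n m) :=
  Ideal.span (Set.range fun i : Fin n => MvPolynomial.X (Sum.inl i))

/-! ### Iterated Hilbert functions, polynomials and coefficients of a graded `S`-module -/

section Graded

variable {K : Type u} [Field K] {N : Type v} [AddCommGroup N] [Module K N]

/-- The Hilbert function `H(N, x) = dim_K N_x` of a graded module `N = ⨁ₓ N_x`. -/
def hilbertFunction (𝒩 : ℤ → Submodule K N) (x : ℤ) : ℤ :=
  (Module.finrank K (𝒩 x) : ℤ)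

/-- The iterated Hilbert functions: `H₀ = H` and `Hᵢ₊₁(N, x) = ∑_{y ≤ x} Hᵢ(N, y)`.
The sum is finite when the components of small degree vanish, hence whenever `N` is a finitely
generated graded `S`-module. -/
def iteratedHilbertFunction (𝒩 : ℤ → Submodule K N) : ℕ → ℤ → ℤ
  | 0, x => hilbertFunction 𝒩 x
  | i + 1, x => ∑ᶠ y ∈ Set.Iic x, iteratedHilbertFunction 𝒩 i y

/-- `P` is the `i`-th iterated Hilbert polynomial: `Hᵢ(N, x) = P(x)` for `x ≫ 0`. -/
def IsIteratedHilbertPolynomial (𝒩 : ℤ → Submodule K N) (i : ℕ) (P : ℚ[X]) : Prop :=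
  ∀ᶠ x : ℤ in atTop, (iteratedHilbertFunction 𝒩 i x : ℚ) = P.eval (x : ℚ)

/-- The binomial coefficient `(x + r choose r)` as a polynomial in `x`. -/
def binomPoly (r : ℕ) : ℚ[X] :=
  C ((r.factorial : ℚ)⁻¹) * ∏ s ∈ Finset.range r, (X + C ((r : ℚ) - (s : ℚ)))

/-- The Krull dimension of an `S`-module as a natural number; it agrees with
`Module.supportDim` on finitely generated nonzero modules, and is `0` on the zero module. -/
def natDim (K : Type u) [Field K] (n : ℕ) (N : Type v) [AddCommGroup N]
    [Module (PolyX K n) N] : ℕ :=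
  ((Module.supportDim (PolyX K n) N).unbotD 0).toNat

/-- `e` is the sequence of `i`-th iterated Hilbert coefficients of the graded `S`-module `N`
of Krull dimension `d`: the `i`-th Hilbert polynomial of `N` is
`P(x) = ∑_{j=0}^{d+i-1} (-1)^j e_j (x + d + i - j - 1 choose d + i - j - 1)`,
where `e_j` is put equal to `0` for `j > d + i - 1`. There is at most one such sequence; it is `0`
if `N = 0`, because then `P = 0`. -/
def IsIteratedHilbertCoeffs (n : ℕ) [Module (PolyX K n) N] (𝒩 : ℤ → Submodule K N) (i : ℕ)
    (e : ℕ → ℤ) : Prop :=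
  IsIteratedHilbertPolynomial 𝒩 i
      (∑ j ∈ Finset.range (natDim K n N + i),
        C ((-1 : ℚ) ^ j * (e j : ℚ)) * binomPoly (natDim K n N + i - 1 - j)) ∧
    ∀ j : ℕ, natDim K n N + i ≤ j → e j = 0

open Classical in
/-- The higher iterated Hilbert coefficient `e^i_j(N)` of a graded `S`-module `N`. -/
def iteratedHilbertCoeff (n : ℕ) [Module (PolyX K n) N] (𝒩 : ℤ → Submodule K N) (i j : ℕ) : ℤ :=
  if h : ∃ e : ℕ → ℤ, IsIteratedHilbertCoeffs n 𝒩 i e then h.choose j else 0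

end Graded

/-! ### The graded components `M_k` of a bigraded `A`-module -/

/-- The `A`-module `M`, regarded as an `S`-module by restriction of scalars. -/
@[nolint unusedArguments]
def RestrictX (_K : Type u) (_n _m : ℕ) (M : Type v) : Type v := M

section Component

variable {K : Type u} [Field K] {n m : ℕ} {M : Type v} [AddCommGroup M]
  [Module K M] [Module (PolyXY K n m) M] [IsScalarTower K (PolyXY K n m) M]

instance : AddCommGroup (RestrictX K n m M) := inferInstanceAs (AddCommGroup M)

instance : Module K (RestrictX K n m M) := inferInstanceAs (Module K M)

instance : Module (PolyX K n) (RestrictX K n m M) :=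
  Module.compHom M (inclX K n m).toRingHom

instance : IsScalarTower K (PolyX K n) (RestrictX K n m M) where
  smul_assoc a f x := by
    change (inclX K n m (a • f) • (show M from x) : M) = a • (inclX K n m f • (show M from x) : M)
    rw [map_smul, smul_assoc]

/-- The `K`-subspace `⨁ᵢ M_(i,k)` of `M`. -/
def componentSpace (ℳ : ℤ × ℤ → Submodule K M) (k : ℤ) : Submodule K M :=
  ⨆ i : ℤ, ℳ (i, k)

theorem inclX_smul_mem (p : Fin m → ℕ) (ℳ : ℤ × ℤ → Submodule K M)
    [SetLike.GradedSMul (bigrading K n p) ℳ] (k : ℤ) (f : PolyX K n) {x : M}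
    (hx : x ∈ componentSpace ℳ k) : inclX K n m f • x ∈ componentSpace ℳ k := by
  induction f using MvPolynomial.induction_on generalizing x with
  | C a =>
    have h : inclX K n m (MvPolynomial.C a) • x = a • x := by
      rw [inclX, MvPolynomial.rename_C, ← MvPolynomial.algebraMap_eq, algebraMap_smul]
    rw [h]
    exact Submodule.smul_mem _ _ hx
  | add f g hf hg =>
    rw [map_add, add_smul]
    exact Submodule.add_mem _ (hf hx) (hg hx)
  | mul_X f i hf =>
    rw [map_mul, mul_smul]
    apply hf
    rw [inclX, MvPolynomial.rename_X]
    unfold componentSpace at hx ⊢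
    induction hx using Submodule.iSup_induction' with
    | mem c y hy =>
      have h1 : (MvPolynomial.X (Sum.inl i) : PolyXY K n m) ∈ bigrading K n p (1, 0) :=
        MvPolynomial.isWeightedHomogeneous_X K (bidegree n p) (Sum.inl i)
      have h2 := SetLike.GradedSMul.smul_mem h1 hy
      have h3 : ((1, 0) : ℤ × ℤ) +ᵥ (c, k) = (1 + c, k) := by
        simp [vadd_eq_add]
      rw [h3] at h2
      exact Submodule.mem_iSup_of_mem (1 + c) h2
    | zero => rw [smul_zero]; exact Submodule.zero_mem _
    | add y z _ _ hy hz => rw [smul_add]; exact Submodule.add_mem _ hy hz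

/-- The `S`-module `M_k = ⨁ᵢ M_(i,k)`. -/
def component (p : Fin m → ℕ) (ℳ : ℤ × ℤ → Submodule K M)
    [SetLike.GradedSMul (bigrading K n p) ℳ] (k : ℤ) :
    Submodule (PolyX K n) (RestrictX K n m M) where
  carrier := {x | (show M from x) ∈ componentSpace ℳ k}
  add_mem' hx hy := Submodule.add_mem (componentSpace ℳ k) hx hy
  zero_mem' := Submodule.zero_mem (componentSpace ℳ k)
  smul_mem' f _ hx := inclX_smul_mem p ℳ k f hx

/-- The grading of `M_k`, whose component of degree `i` is `M_(i,k)`. -/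
def componentGrading (p : Fin m → ℕ) (ℳ : ℤ × ℤ → Submodule K M)
    [SetLike.GradedSMul (bigrading K n p) ℳ] (k i : ℤ) :
    Submodule K (component (n := n) p ℳ k) :=
  Submodule.comap ((component (n := n) p ℳ k).subtype.restrictScalars K)
    (show Submodule K (RestrictX K n m M) from ℳ (i, k))

/-- The limit dimension `ldim M = lim_{k → ∞} dim M_k`. -/
def ldim (p : Fin m → ℕ) (ℳ : ℤ × ℤ → Submodule K M)
    [SetLike.GradedSMul (bigrading K n p) ℳ] : WithBot ℕ∞ :=
  limsup (fun k : ℤ => Module.supportDim (PolyX K n) (component (n := n) p ℳ k)) atTop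

end Component

end BigradedHilbert

end

open BigradedHilbert

noncomputable section

namespace BigradedHilbert

set_option linter.unusedSectionVars false
open scoped Pointwise

/-! ### Krull dimension and growth -/

/-! Since all `p t` equal `p₀`, set `a = i - p₀ * k`. In the coordinates `(a, k)` each `xᵢ` has
degree `(1, 0)` and each `yⱼ` has degree `(0, 1)`, so by Hilbert–Serre the Hilbert series of `M` is
a Laurent polynomial over `(1 - s)^n (1 - t)^m` (`exists_eq_rationalCoeff`). Summing `i` times over
the `x`-degree replaces `n` by `n + i`. Vandermonde then separates the variables: for large `a` and
`k` the `i`-th iterated Hilbert function is `∑ l, binomPoly l (a) * coeffPoly (n + i - l) (k)`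
(`rationalCoeff_eq_sum`).

Two growth estimates control the coefficients; both rest on `growth_le`, which follows from Noether
normalization. For fixed `k`, the partial sums over `a` grow at most like `a ^ dim M_k`. Hence the
terms with `l ≥ dim M_k + i` vanish. For fixed `a`, the column `⨁ₖ M_(a + p₀ k, k)` meets `𝔪 ^ s M`
trivially once `s` is large, so it embeds in `M / 𝔪 ^ s M`, which has the same support as `M / 𝔪 M`.
The partial sums over `k` therefore grow at most like `k ^ δ` with `δ = dim M / 𝔪 M`, and taking
differences gives every `coeffPoly` degree less than `δ`.

Returning to `x = a + p₀ * k` by a second use of Vandermonde, the coefficient of `binomPoly l (x)`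
collects the products of `coeffPoly` with `binomPoly (l' - l) (-1 - p₀ k)`, where `l ≤ l' ≤ d + i -
1` and `d = ldim M`. For `l = d + i - 1 - j` the second factor has degree at most `j` in `k`, whence
the bound `δ + j - 1`.

The dimension of `M_k` stabilizes because the annihilators of the `M_k` eventually form an ascending
chain in a Noetherian ring. -/

theorem ringKrullDim_le_of_integral_injective {R S : Type*} [CommRing R] [CommRing S] (f : R →+* S)
    (hf : Function.Injective f) (hi : f.IsIntegral) : ringKrullDim R ≤ ringKrullDim S := by
  algebraize [f]
  have hinj : Function.Injective (algebraMap R S) := hf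
  unfold ringKrullDim
  refine iSup_le fun l => ?_
  obtain ⟨P, -, hP, hPl⟩ := Ideal.exists_ideal_over_prime_of_isIntegral
    (S := S) (RelSeries.head l).asIdeal ⊥ (by
      rw [← RingHom.ker_eq_comap_bot, (RingHom.injective_iff_ker_eq_bot _).1 hinj]; exact bot_le)
  have : P.LiesOver (RelSeries.head l).asIdeal := ⟨hPl.symm⟩
  obtain ⟨L, hL, -, -⟩ := Ideal.exists_ltSeries_of_hasGoingUp l P
  rw [← hL]
  exact Order.LTSeries.length_le_krullDim L

theorem card_degree_le (s y : ℕ) :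
    ∃ F : Finset (Fin s →₀ ℕ), (∀ β : Fin s →₀ ℕ, β.degree ≤ y → β ∈ F) ∧
      F.card ≤ (y + 1) ^ s := by
  classical
  refine ⟨(Fintype.piFinset fun _ : Fin s => Finset.range (y + 1)).image
    (fun f => Finsupp.equivFunOnFinite.symm f), fun β hβ => ?_, ?_⟩
  · refine Finset.mem_image.2 ⟨β, ?_, ?_⟩
    · rw [Fintype.mem_piFinset]
      intro i
      have := Finsupp.le_degree i β
      rw [Finset.mem_range]; omega
    · ext; simp
  · refine Finset.card_image_le.trans ?_
    simp

/-- The Krull dimension of the support as a natural number (`0` for the zero module). -/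
def supportNatDim (R : Type*) [CommRing R] (N : Type*) [AddCommGroup N] [Module R N] : ℕ :=
  ((Module.supportDim R N).unbotD 0).toNat

theorem supportDim_eq_bot_or_eq_natCast {σ K N : Type*} [Finite σ] [Field K] [AddCommGroup N]
    [Module (MvPolynomial σ K) N] :
    Module.supportDim (MvPolynomial σ K) N = ⊥ ∨
      Module.supportDim (MvPolynomial σ K) N = (supportNatDim (MvPolynomial σ K) N : ℕ) := by
  unfold supportNatDim
  have hle : Module.supportDim (MvPolynomial σ K) N ≤ (Nat.card σ : ℕ) := by
    have := Module.supportDim_le_ringKrullDim (MvPolynomial σ K) N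
    rw [MvPolynomial.ringKrullDim_of_isNoetherianRing, ringKrullDim_eq_zero_of_field] at this
    simpa using this
  generalize Module.supportDim (MvPolynomial σ K) N = d at hle
  induction d with
  | bot => exact Or.inl rfl
  | coe d =>
    induction d with
    | top => exact absurd (WithBot.coe_le_coe.1 hle) (by simp)
    | coe d => exact Or.inr rfl

section Growth

variable {K : Type*} [Field K] {σ : Type*}

/-- The `K`-span of the elements `f • g` with `g ∈ G` and `f` a monomial of degree at most `x`. -/
def growthSpan (K : Type*) [Field K] {σ : Type*} {N : Type*} [AddCommGroup N]
    [Module K N] [Module (MvPolynomial σ K) N] (G : Finset N) (x : ℕ) : Submodule K N :=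
  Submodule.span K {n | ∃ α : σ →₀ ℕ, α.degree ≤ x ∧ ∃ g ∈ G,
    n = (MvPolynomial.monomial α (1 : K)) • g}

/-- By Noether normalization `Q` is finite over a polynomial ring in `s ≤ dim Q` variables.
Multiplication by the image of a variable raises the degree filtration that the finite generators
induce by at most a constant `D`, so monomials of degree at most `x` stay in filtration degree `D *
(x + 1)`, and that step has a spanning set of size polynomial of degree `s` in `x`. -/
theorem quotient_growth {Q : Type*} [CommRing Q] [Nontrivial Q] [Algebra K Q] [Finite σ]
    (π : MvPolynomial σ K →ₐ[K] Q) (hπ : Function.Surjective π) :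
    ∃ (s D b : ℕ), (s : WithBot ℕ∞) ≤ ringKrullDim Q ∧ ∀ x : ℕ, ∃ F : Finset Q,
      F.card ≤ b * (D * (x + 1) + 1) ^ s ∧ ∀ α : σ →₀ ℕ, α.degree ≤ x →
        π (MvPolynomial.monomial α 1) ∈ Submodule.span K (F : Set Q) := by
  classical
  have := Fintype.ofFinite σ
  have : Algebra.FiniteType K Q := Algebra.FiniteType.of_surjective π hπ
  obtain ⟨s, g, hg, hfin⟩ := exists_finite_inj_algHom_of_fg K Q
  have hdim : (s : WithBot ℕ∞) ≤ ringKrullDim Q := by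
    have h := ringKrullDim_le_of_integral_injective g.toRingHom hg hfin.to_isIntegral
    rw [MvPolynomial.ringKrullDim_of_isNoetherianRing, ringKrullDim_eq_zero_of_field] at h
    simpa using h
  algebraize [g.toRingHom]
  have hfin' : Module.Finite (MvPolynomial (Fin s) K) Q := hfin
  have : IsScalarTower K (MvPolynomial (Fin s) K) Q := IsScalarTower.of_algebraMap_eq
    fun a => (g.commutes a).symm
  obtain ⟨E, hE⟩ := hfin'.fg_top
  -- `W y` is spanned by the `g(β) e` with `β` of degree at most `y`
  let W : ℕ → Submodule K Q := fun y => Submodule.span K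
    {q | ∃ β : Fin s →₀ ℕ, β.degree ≤ y ∧ ∃ e ∈ E, q = MvPolynomial.monomial β (1 : K) • e}
  have hWmono : Monotone W := fun y z h => Submodule.span_mono
    fun q ⟨β, hβ, e, he, hq⟩ => ⟨β, hβ.trans h, e, he, hq⟩
  have hWtop : ∀ q : Q, ∃ y, q ∈ W y := by
    intro q
    have hq : q ∈ Submodule.span (MvPolynomial (Fin s) K) (E : Set Q) := hE ▸ Submodule.mem_top
    induction hq using Submodule.span_induction with
    | mem e he => exact ⟨0, Submodule.subset_span ⟨0, by simp, e, he, by simp⟩⟩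
    | zero => exact ⟨0, Submodule.zero_mem _⟩
    | add a b _ _ ha hb =>
      obtain ⟨y, hy⟩ := ha
      obtain ⟨z, hz⟩ := hb
      exact ⟨max y z, Submodule.add_mem _ (hWmono (le_max_left _ _) hy)
        (hWmono (le_max_right _ _) hz)⟩
    | smul r a _ ha =>
      obtain ⟨y, hy⟩ := ha
      obtain ⟨z, hz⟩ : ∃ z, z = r.totalDegree + y := ⟨_, rfl⟩
      refine ⟨z, ?_⟩
      rw [MvPolynomial.as_sum r, Finset.sum_smul]
      refine Submodule.sum_mem _ fun β hβ => ?_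
      have hβ' : β.degree ≤ r.totalDegree := MvPolynomial.le_totalDegree hβ
      rename_i ha'
      clear ha'
      induction hy using Submodule.span_induction with
      | mem q hq =>
        obtain ⟨β', hβ'', e, he, rfl⟩ := hq
        have : MvPolynomial.monomial β (MvPolynomial.coeff β r) •
            MvPolynomial.monomial β' (1 : K) • e =
            (MvPolynomial.coeff β r) • MvPolynomial.monomial (β + β') (1 : K) • e := by
          rw [smul_smul, MvPolynomial.monomial_mul, ← smul_assoc, MvPolynomial.smul_monomial]
          simp
        rw [this]
        exact Submodule.smul_mem _ _ (Submodule.subset_span ⟨_, by rw [map_add]; omega, e, he, rfl⟩)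
      | zero => rw [smul_zero]; exact Submodule.zero_mem _
      | add a b _ _ ha hb => rw [smul_add]; exact Submodule.add_mem _ ha hb
      | smul c a _ ha => rw [smul_comm]; exact Submodule.smul_mem _ _ ha
  choose τ hτ using hWtop
  -- `D` bounds the filtration degree of `1` and of every product of a variable with a generator;
  -- the latter products determine all others because the filtration is compatible with
  -- multiplication by `g`.
  let D := τ 1 + ∑ i : σ, ∑ e ∈ E, τ (π (MvPolynomial.X i) * e)
  have hD1 : (1 : Q) ∈ W D := hWmono (Nat.le_add_right _ _) (hτ 1)
  have hDX : ∀ i, ∀ e ∈ E, π (MvPolynomial.X i) * e ∈ W D := by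
    intro i e he
    refine hWmono ?_ (hτ _)
    refine le_trans ?_ (Nat.le_add_left _ _)
    refine le_trans ?_ (Finset.single_le_sum (f := fun i => ∑ e ∈ E, τ (π (MvPolynomial.X i) * e))
      (fun _ _ => Nat.zero_le _) (Finset.mem_univ i))
    exact Finset.single_le_sum (f := fun e => τ (π (MvPolynomial.X i) * e))
      (fun _ _ => Nat.zero_le _) he
  have hmono : ∀ β : Fin s →₀ ℕ, ∀ y, ∀ q ∈ W y,
      MvPolynomial.monomial β (1 : K) • q ∈ W (β.degree + y) := by
    intro β y q hq
    induction hq using Submodule.span_induction with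
    | mem q hq =>
      obtain ⟨β', hβ'', e, he, rfl⟩ := hq
      rw [smul_smul, MvPolynomial.monomial_mul, one_mul]
      exact Submodule.subset_span ⟨_, by rw [map_add]; omega, e, he, rfl⟩
    | zero => rw [smul_zero]; exact Submodule.zero_mem _
    | add a b _ _ ha hb => rw [smul_add]; exact Submodule.add_mem _ ha hb
    | smul c a _ ha => rw [smul_comm]; exact Submodule.smul_mem _ _ ha
  have hX : ∀ i y, ∀ q ∈ W y, π (MvPolynomial.X i) * q ∈ W (y + D) := by
    intro i y q hq
    induction hq using Submodule.span_induction with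
    | mem q hq =>
      obtain ⟨β, hβ, e, he, rfl⟩ := hq
      rw [mul_smul_comm]
      exact hWmono (by omega) (hmono β D _ (hDX i e he))
    | zero => rw [mul_zero]; exact Submodule.zero_mem _
    | add a b _ _ ha hb => rw [mul_add]; exact Submodule.add_mem _ ha hb
    | smul c a _ ha => rw [mul_smul_comm]; exact Submodule.smul_mem _ _ ha
  have hpow : ∀ x : ℕ, ∀ α : σ →₀ ℕ, α.degree = x →
      π (MvPolynomial.monomial α 1) ∈ W (D * (x + 1)) := by
    intro x
    induction x with
    | zero =>
      intro α hα
      rw [Finsupp.degree_eq_zero_iff] at hα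
      subst hα
      simpa using hD1
    | succ x ih =>
      intro α hα
      obtain ⟨i, hi⟩ : ∃ i, α i ≠ 0 := by
        by_contra! h
        have : α = 0 := by ext i; exact h i
        subst this
        simp at hα
      have h1 : Finsupp.single i 1 + (α - Finsupp.single i 1) = α :=
        add_tsub_cancel_of_le (Finsupp.single_le_iff.2 (Nat.one_le_iff_ne_zero.2 hi))
      have h2 : (α - Finsupp.single i 1).degree = x := by
        have := congrArg Finsupp.degree h1
        rw [map_add, Finsupp.degree_single] at this
        omega
      have h3 := hX i _ _ (ih _ h2)
      rw [← map_mul, MvPolynomial.X, MvPolynomial.monomial_mul, h1, one_mul] at h3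
      exact h3
  refine ⟨s, D, E.card, hdim, fun x => ?_⟩
  obtain ⟨F, hF, hFc⟩ := card_degree_le s (D * (x + 1))
  refine ⟨Finset.image₂ (fun e β => MvPolynomial.monomial β (1 : K) • e) E F,
    (Finset.card_image₂_le _ _ _).trans (Nat.mul_le_mul_left _ hFc), fun α hα => ?_⟩
  have h := hWmono (Nat.mul_le_mul_left D (Nat.succ_le_succ hα)) (hpow _ α rfl)
  refine Submodule.span_mono ?_ h
  rintro q ⟨β, hβ, e, he, rfl⟩
  exact Finset.mem_image₂_of_mem he (hF _ hβ)

theorem growthSpan_fg [Finite σ] {N : Type*} [AddCommGroup N] [Module K N]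
    [Module (MvPolynomial σ K) N] (G : Finset N) (x : ℕ) : (growthSpan K (σ := σ) G x).FG := by
  refine Submodule.fg_span ?_
  have h1 : {α : σ →₀ ℕ | α.degree ≤ x}.Finite := by
    have := Fintype.ofFinite σ
    classical
    refine (Set.finite_Iic (Finsupp.equivFunOnFinite.symm fun _ : σ => x)).subset ?_
    intro α hα i
    exact (Finsupp.le_degree i α).trans hα
  refine (h1.image2 (fun (α : σ →₀ ℕ) (g : N) => MvPolynomial.monomial α (1 : K) • g)
    G.finite_toSet).subset ?_
  rintro n ⟨α, hα, g, hg, rfl⟩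
  exact Set.mem_image2_of_mem hα hg

/-- The growth of a finitely generated module over a polynomial ring is bounded by its dimension. -/
theorem growth_le [Finite σ] {N : Type*} [AddCommGroup N] [Module K N]
    [Module (MvPolynomial σ K) N] [IsScalarTower K (MvPolynomial σ K) N]
    [Module.Finite (MvPolynomial σ K) N] (G : Finset N) :
    ∃ C : ℕ, ∀ x : ℕ, Module.finrank K (growthSpan K (σ := σ) G x) ≤
      C * (x + 1) ^ supportNatDim (MvPolynomial σ K) N := by
  classical
  rcases subsingleton_or_nontrivial N with hN | hN
  · exact ⟨0, fun x => by
      rw [Module.finrank_zero_of_subsingleton]; simp⟩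
  set I := Module.annihilator (MvPolynomial σ K) N with hI
  have hdimN : Module.supportDim (MvPolynomial σ K) N = ringKrullDim (MvPolynomial σ K ⧸ I) :=
    Module.supportDim_eq_ringKrullDim_quotient_annihilator _ _
  have : Nontrivial (MvPolynomial σ K ⧸ I) := by
    by_contra hQ
    rw [not_nontrivial_iff_subsingleton] at hQ
    rw [ringKrullDim_eq_bot_of_subsingleton] at hdimN
    exact Module.supportDim_ne_bot_of_nontrivial _ _ hdimN
  obtain ⟨s, D, b, hs, h⟩ := quotient_growth (Ideal.Quotient.mkₐ K I)
    (Ideal.Quotient.mkₐ_surjective K I)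
  have hs' : s ≤ supportNatDim (MvPolynomial σ K) N := by
    rw [← hdimN] at hs
    rcases supportDim_eq_bot_or_eq_natCast (K := K) (σ := σ) (N := N) with h0 | h0
    · exact absurd h0 (Module.supportDim_ne_bot_of_nontrivial _ _)
    · rw [h0] at hs
      exact_mod_cast hs
  -- Evaluation at `g` factors through the quotient by the annihilator, so the growth of `N` is at
  -- most `G.card` times that of the quotient ring, whose dimension is that of `N`.
  let φ : N → ((MvPolynomial σ K ⧸ I) →ₗ[MvPolynomial σ K] N) := fun g =>
    Submodule.liftQ I (LinearMap.toSpanSingleton (MvPolynomial σ K) N g) (by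
      intro r hr
      rw [LinearMap.mem_ker, LinearMap.toSpanSingleton_apply]
      exact Module.mem_annihilator.1 hr g)
  refine ⟨G.card * (b * (D + 1) ^ s), fun x => ?_⟩
  obtain ⟨F, hFc, hF⟩ := h x
  have hle : growthSpan K (σ := σ) G x ≤
      Submodule.span K (Finset.image₂ (fun g q => φ g q) G F : Set N) := by
    refine Submodule.span_le.2 ?_
    rintro n ⟨α, hα, g, hg, rfl⟩
    have h1 : MvPolynomial.monomial α (1 : K) • g =
        ((φ g).restrictScalars K) (Ideal.Quotient.mkₐ K I (MvPolynomial.monomial α 1)) := rfl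
    rw [h1]
    have h2 := Submodule.mem_map_of_mem (f := (φ g).restrictScalars K) (hF α hα)
    rw [Submodule.map_span] at h2
    refine Submodule.span_mono ?_ h2
    rintro _ ⟨q, hq, rfl⟩
    exact Finset.mem_image₂_of_mem hg hq
  have hfd := FiniteDimensional.span_finset K (Finset.image₂ (fun g q => φ g q) G F)
  calc _ ≤ _ := Submodule.finrank_mono hle
    _ ≤ _ := finrank_span_finset_le_card _
    _ ≤ G.card * F.card := Finset.card_image₂_le _ _ _
    _ ≤ G.card * (b * (D * (x + 1) + 1) ^ s) := Nat.mul_le_mul_left _ hFc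
    _ ≤ G.card * (b * ((D + 1) * (x + 1)) ^ s) := by gcongr; nlinarith
    _ = G.card * (b * (D + 1) ^ s) * (x + 1) ^ s := by rw [mul_pow]; ring
    _ ≤ _ := by gcongr; omega

end Growth

/-! ### Multigraded modules over polynomial rings -/

section Proj

variable {K : Type*} [Field K] {M : Type*} [AddCommGroup M] [Module K M]
  {G : Type*} [DecidableEq G] (ℳ : G → Submodule K M) [DirectSum.Decomposition ℳ]

/-- The projection of a graded module onto its component of degree `c`. -/
def proj (c : G) : M →ₗ[K] M :=
  (ℳ c).subtype ∘ₗ DirectSum.component K G (fun i => ℳ i) c ∘ₗ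
    (DirectSum.decomposeLinearEquiv ℳ).toLinearMap

theorem proj_mem (c : G) (x : M) : proj ℳ c x ∈ ℳ c := (DirectSum.decompose ℳ x c).2

variable {ℳ}

theorem proj_of_mem {c : G} {x : M} (hx : x ∈ ℳ c) : proj ℳ c x = x :=
  DirectSum.decompose_of_mem_same ℳ hx

theorem proj_of_mem_ne {c d : G} {x : M} (hx : x ∈ ℳ c) (h : c ≠ d) : proj ℳ d x = 0 :=
  DirectSum.decompose_of_mem_ne ℳ hx h

theorem exists_eq_sum_proj (x : M) : ∃ F : Finset G, x = ∑ c ∈ F, proj ℳ c x := by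
  classical
  exact ⟨_, (DirectSum.sum_support_decompose ℳ x).symm⟩

/-- The last hypothesis makes `φ` injective on the direct sum of the components with degree in `F`.
It is used with a quotient map modulo `𝔪 ^ s M` for columns and with the identity for rows. -/
theorem sum_finrank_le_of_injOn {N : Type*} [AddCommGroup N] [Module K N] (φ : M →ₗ[K] N)
    (W : Submodule K N) (hW : W.FG) (F : Finset G) (hF : ∀ c ∈ F, ∀ x ∈ ℳ c, φ x ∈ W)
    (hφ : ∀ x, φ x = 0 → ∀ c ∈ F, proj ℳ c x = 0) :
    ∑ c ∈ F, Module.finrank K (ℳ c) ≤ Module.finrank K W := by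
  classical
  have : Module.Finite K W := Module.Finite.iff_fg.2 hW
  let ψ : (Π c : F, ℳ c) →ₗ[K] M := ∑ c : F, (ℳ c).subtype ∘ₗ LinearMap.proj c
  have hψ : ∀ f, ψ f = ∑ c : F, (f c : M) := fun f => by simp [ψ]
  have hproj : ∀ f, ∀ c : F, proj ℳ c (ψ f) = f c := by
    intro f c
    rw [hψ, map_sum, Finset.sum_eq_single c]
    · exact proj_of_mem (f c).2
    · intro d _ hd
      exact proj_of_mem_ne (f d).2 fun h => hd (Subtype.ext h)
    · simp
  let χ : (Π c : F, ℳ c) →ₗ[K] W := (φ ∘ₗ ψ).codRestrict W fun f => by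
    rw [LinearMap.comp_apply, hψ, map_sum]
    exact Submodule.sum_mem _ fun c _ => hF c c.2 _ (f c).2
  have hχ : Function.Injective χ := by
    rw [injective_iff_map_eq_zero]
    intro f hf
    have h1 : φ (ψ f) = 0 := congrArg Subtype.val hf
    funext c
    have h2 := hφ _ h1 c c.2
    rw [hproj] at h2
    exact Subtype.ext h2
  have hfin : ∀ c : F, Module.Finite K (ℳ c) := by
    intro c
    refine Module.Finite.of_injective (χ ∘ₗ LinearMap.single K (fun c : F => ℳ c) c) ?_
    refine hχ.comp fun x y hxy => ?_
    simpa using congrFun hxy c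
  have h := LinearMap.finrank_le_finrank_of_injective hχ
  rw [Module.finrank_pi_fintype] at h
  rwa [← Finset.sum_coe_sort F]

end Proj

/-! ### Rationality of multigraded Hilbert series, expressed by iterated differences -/

section RationalFunction

variable {G : Type*} [AddCommGroup G]

/-- The iterated differences of `f` along the degrees in the list `l` have finite support. -/
def IsRationalFunction : List G → (G → ℤ) → Prop
  | [], f => (Function.support f).Finite
  | d :: l, f => IsRationalFunction l fun c => f c - f (c - d)

theorem IsRationalFunction.sub {l : List G} {f g : G → ℤ} (hf : IsRationalFunction l f)
    (hg : IsRationalFunction l g) : IsRationalFunction l fun c => f c - g c := by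
  induction l generalizing f g with
  | nil => exact (hf.union hg).subset (Function.support_sub f g)
  | cons d l ih =>
    have := ih hf hg
    refine (congrArg (IsRationalFunction l) ?_).mp this
    funext c
    ring

theorem IsRationalFunction.shift {l : List G} {f : G → ℤ} (hf : IsRationalFunction l f) (e : G) :
    IsRationalFunction l fun c => f (c - e) := by
  induction l generalizing f with
  | nil => exact Set.Finite.preimage (sub_left_injective.injOn) hf
  | cons d l ih =>
    have := ih hf
    refine (congrArg (IsRationalFunction l) ?_).mp this
    funext c
    rw [sub_right_comm]

end RationalFunction

/-! ### The Hilbert–Serre theorem for multigraded modules -/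

section Graded

variable {K : Type*} [Field K] {σ : Type*} {M : Type*} [AddCommGroup M] [Module K M]
  [Module (MvPolynomial σ K) M] [IsScalarTower K (MvPolynomial σ K) M]
  {G : Type*} [AddCommGroup G] [DecidableEq G] {ℳ : G → Submodule K M}
  [DirectSum.Decomposition ℳ] {w : σ → G}

/-- The module `M` is graded if the variable `Xᵢ` has degree `wᵢ`. -/
def IsGradedBy (ℳ : G → Submodule K M) (w : σ → G) : Prop :=
  ∀ i c, ∀ x ∈ ℳ c, (MvPolynomial.X i : MvPolynomial σ K) • x ∈ ℳ (w i + c)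

theorem C_smul (a : K) (x : M) : (MvPolynomial.C a : MvPolynomial σ K) • x = a • x := by
  rw [← MvPolynomial.algebraMap_eq, algebraMap_smul]

theorem IsGradedBy.proj_X_smul (h : IsGradedBy ℳ w) (i : σ) (c : G) (x : M) :
    proj ℳ (w i + c) ((MvPolynomial.X i : MvPolynomial σ K) • x) =
      (MvPolynomial.X i : MvPolynomial σ K) • proj ℳ c x := by
  induction x using DirectSum.Decomposition.inductionOn ℳ with
  | zero => simp
  | @homogeneous d x =>
    by_cases hd : d = c
    · subst hd
      rw [proj_of_mem x.2, proj_of_mem (h i d x x.2)]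
    · rw [proj_of_mem_ne x.2 hd, smul_zero,
        proj_of_mem_ne (h i d x x.2) fun h => hd (add_left_cancel h)]
  | add x y hx hy => rw [smul_add, map_add, map_add, smul_add, hx, hy]

theorem IsGradedBy.proj_X_smul' (h : IsGradedBy ℳ w) (i : σ) (c : G) (x : M) :
    proj ℳ c ((MvPolynomial.X i : MvPolynomial σ K) • x) =
      (MvPolynomial.X i : MvPolynomial σ K) • proj ℳ (c - w i) x := by
  rw [← h.proj_X_smul, add_sub_cancel]

theorem IsGradedBy.monomial_smul_mem (h : IsGradedBy ℳ w) (α : σ →₀ ℕ) {c : G} {x : M}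
    (hx : x ∈ ℳ c) :
    MvPolynomial.monomial α (1 : K) • x ∈ ℳ (Finsupp.weight w α + c) := by
  induction α using Finsupp.induction_linear generalizing x c with
  | zero => simpa using hx
  | add f g hf hg =>
    have : MvPolynomial.monomial (f + g) (1 : K) =
        MvPolynomial.monomial f 1 * MvPolynomial.monomial g 1 := by
      rw [MvPolynomial.monomial_mul, one_mul]
    rw [this, mul_smul, map_add, add_assoc]
    exact hf (hg hx)
  | single i n =>
    rw [MvPolynomial.monomial_eq, MvPolynomial.C_1, one_mul, Finsupp.prod_single_index (by simp),
      Finsupp.weight_single]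
    induction n with
    | zero => simpa using hx
    | succ n ih =>
      rw [pow_succ', mul_smul, succ_nsmul', add_assoc]
      exact h _ _ _ ih

/-- A submodule that contains the homogeneous components of its elements. -/
def IsHomog (ℳ : G → Submodule K M) [DirectSum.Decomposition ℳ]
    (U : Submodule (MvPolynomial σ K) M) : Prop :=
  ∀ x ∈ U, ∀ c, proj ℳ c x ∈ U

/-- The Hilbert function of a submodule. -/
def submoduleHilbert (ℳ : G → Submodule K M) (U : Submodule (MvPolynomial σ K) M) (c : G) : ℤ :=
  (Module.finrank K (U.restrictScalars K ⊓ ℳ c : Submodule K M) : ℤ)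

theorem exists_homogeneous_generators [Finite σ] [Module.Finite (MvPolynomial σ K) M]
    {U : Submodule (MvPolynomial σ K) M} (hU : IsHomog ℳ U) :
    ∃ Γ : Finset (G × M), (∀ γ ∈ Γ, γ.2 ∈ ℳ γ.1) ∧
      Submodule.span (MvPolynomial σ K) (Prod.snd '' (Γ : Set (G × M))) = U := by
  classical
  obtain ⟨S, hS⟩ := IsNoetherian.noetherian U
  choose F hF using fun x : M => exists_eq_sum_proj (ℳ := ℳ) x
  refine ⟨S.biUnion fun x => (F x).image fun c => (c, proj ℳ c x), ?_, ?_⟩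
  · intro γ hγ
    simp only [Finset.mem_biUnion, Finset.mem_image] at hγ
    obtain ⟨x, _, c, _, rfl⟩ := hγ
    exact proj_mem ℳ c x
  · apply le_antisymm
    · rw [Submodule.span_le]
      rintro _ ⟨γ, hγ, rfl⟩
      simp only [Finset.coe_biUnion, Set.mem_iUnion, Finset.mem_coe, Finset.mem_image] at hγ
      obtain ⟨x, hx, c, _, rfl⟩ := hγ
      exact hU x (hS ▸ Submodule.subset_span hx) c
    · rw [← hS, Submodule.span_le]
      intro x hx
      rw [SetLike.mem_coe, hF x]
      refine Submodule.sum_mem _ fun c hc => Submodule.subset_span ?_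
      refine ⟨(c, proj ℳ c x), ?_, rfl⟩
      simp only [Finset.coe_biUnion, Set.mem_iUnion, Finset.mem_coe, Finset.mem_image]
      exact ⟨x, hx, c, hc, rfl⟩

theorem span_monomial_eq_top :
    Submodule.span K (Set.range fun α : σ →₀ ℕ => MvPolynomial.monomial α (1 : K)) = ⊤ := by
  rw [← MvPolynomial.coe_basisMonomials]
  exact (MvPolynomial.basisMonomials σ K).span_eq

/-- A component of a graded module is spanned by the multiples by monomials of homogeneous
generators. -/
theorem IsGradedBy.le_span (h : IsGradedBy ℳ w) {Γ : Set (G × M)} (hΓ : ∀ γ ∈ Γ, γ.2 ∈ ℳ γ.1)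
    (hspan : Submodule.span (MvPolynomial σ K) (Prod.snd '' Γ) = ⊤) (c : G) :
    ℳ c ≤ Submodule.span K {x | ∃ α : σ →₀ ℕ, ∃ γ ∈ Γ, Finsupp.weight w α + γ.1 = c ∧
      x = MvPolynomial.monomial α (1 : K) • γ.2} := by
  intro x hx
  rw [← proj_of_mem hx]
  have hx' : x ∈ Submodule.span K ((Set.range fun α : σ →₀ ℕ =>
      MvPolynomial.monomial α (1 : K)) • (Prod.snd '' Γ)) := by
    rw [Submodule.span_smul_of_span_eq_top span_monomial_eq_top, hspan]
    trivial
  clear hx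
  induction hx' using Submodule.span_induction with
  | mem x hx =>
    obtain ⟨_, ⟨α, rfl⟩, _, ⟨γ, hγ, rfl⟩, rfl⟩ := hx
    have h1 := h.monomial_smul_mem α (hΓ γ hγ)
    by_cases hc : Finsupp.weight w α + γ.1 = c
    · subst hc
      dsimp only
      rw [proj_of_mem h1]
      exact Submodule.subset_span ⟨α, γ, hγ, rfl, rfl⟩
    · dsimp only
      rw [proj_of_mem_ne h1 hc]
      exact Submodule.zero_mem _
  | zero => rw [map_zero]; exact Submodule.zero_mem _
  | add x y _ _ hx hy => rw [map_add]; exact Submodule.add_mem _ hx hy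
  | smul a x _ hx => rw [map_smul]; exact Submodule.smul_mem _ _ hx

/-- Rank–nullity for `(u, v) ↦ Xᵢ u + v` on `U_(c - wᵢ) × V_c`: the image is the component of `V +
Xᵢ U`, and the kernel is isomorphic to the component of `U ∩ (V : Xᵢ)`. Thus the difference of the
Hilbert function of `U / V` along `wᵢ` is expressed by two subquotients on which `Xᵢ` acts as zero.
-/
theorem submoduleHilbert_step (h : IsGradedBy ℳ w) (hfin : ∀ c, Module.Finite K (ℳ c))
    {U V : Submodule (MvPolynomial σ K) M} (hU : IsHomog ℳ U) (hV : IsHomog ℳ V) (i : σ) (c : G) :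
    submoduleHilbert ℳ (V ⊔ U.map (LinearMap.lsmul (MvPolynomial σ K) M (MvPolynomial.X i))) c +
      submoduleHilbert ℳ (U ⊓ V.comap (LinearMap.lsmul (MvPolynomial σ K) M (MvPolynomial.X i)))
        (c - w i) = submoduleHilbert ℳ V c + submoduleHilbert ℳ U (c - w i) := by
  set μ := LinearMap.lsmul (MvPolynomial σ K) M (MvPolynomial.X i) with hμ
  have hμ' : ∀ x, μ x = (MvPolynomial.X i : MvPolynomial σ K) • x := fun _ => rfl
  let U' : Submodule K M := U.restrictScalars K ⊓ ℳ (c - w i)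
  let V' : Submodule K M := V.restrictScalars K ⊓ ℳ c
  have hU' : Module.Finite K U' :=
    Submodule.finiteDimensional_of_le (inf_le_right : U' ≤ ℳ (c - w i))
  have hV' : Module.Finite K V' := Submodule.finiteDimensional_of_le (inf_le_right : V' ≤ ℳ c)
  let ψ : U' × V' →ₗ[K] M := (μ.restrictScalars K ∘ₗ U'.subtype).coprod V'.subtype
  have hψ : ∀ u v, ψ (u, v) = (MvPolynomial.X i : MvPolynomial σ K) • (u : M) + v := fun u v => rfl
  have hrange : LinearMap.range ψ = (V ⊔ U.map μ).restrictScalars K ⊓ ℳ c := by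
    ext y
    constructor
    · rintro ⟨⟨u, v⟩, rfl⟩
      rw [hψ]
      refine ⟨?_, ?_⟩
      · exact Submodule.add_mem _ (Submodule.mem_sup_right ⟨u, u.2.1, rfl⟩)
          (Submodule.mem_sup_left v.2.1)
      · refine Submodule.add_mem _ ?_ v.2.2
        have := h i _ _ u.2.2
        rwa [add_sub_cancel] at this
    · rintro ⟨hy1, hy2⟩
      obtain ⟨v, hv, _, ⟨u, hu, rfl⟩, hvu⟩ := Submodule.mem_sup.1 hy1
      refine ⟨(⟨proj ℳ (c - w i) u, hU u hu _, proj_mem ℳ _ _⟩,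
        ⟨proj ℳ c v, hV v hv _, proj_mem ℳ _ _⟩), ?_⟩
      rw [hψ]
      dsimp only
      rw [← h.proj_X_smul', ← map_add, add_comm, ← hμ', hvu, proj_of_mem hy2]
  have hker : Module.finrank K (LinearMap.ker ψ) =
      Module.finrank K ((U ⊓ V.comap μ).restrictScalars K ⊓ ℳ (c - w i) : Submodule K M) := by
    have hmem : ∀ z : LinearMap.ker ψ, (z.1.1 : M) ∈
        ((U ⊓ V.comap μ).restrictScalars K ⊓ ℳ (c - w i) : Submodule K M) := by
      rintro ⟨⟨u, v⟩, hz⟩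
      rw [LinearMap.mem_ker, hψ] at hz
      refine ⟨⟨u.2.1, ?_⟩, u.2.2⟩
      have := V.neg_mem v.2.1
      rw [← eq_neg_iff_add_eq_zero.2 hz] at this
      exact this
    refine LinearEquiv.finrank_eq (LinearEquiv.ofBijective
      ((U'.subtype ∘ₗ LinearMap.fst K U' V' ∘ₗ (LinearMap.ker ψ).subtype).codRestrict _ hmem)
      ⟨?_, ?_⟩)
    · rw [injective_iff_map_eq_zero]
      rintro ⟨⟨u, v⟩, hz⟩ h0
      have hu : (u : M) = 0 := congrArg Subtype.val h0
      rw [LinearMap.mem_ker, hψ, hu, smul_zero, zero_add] at hz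
      have hu' : u = 0 := Subtype.ext hu
      have hv' : v = 0 := Subtype.ext hz
      subst hu' hv'
      rfl
    · rintro ⟨x, ⟨hx1, hx2⟩, hx3⟩
      refine ⟨⟨(⟨x, hx1, hx3⟩, ⟨-((MvPolynomial.X i : MvPolynomial σ K) • x), V.neg_mem hx2, ?_⟩),
        ?_⟩, rfl⟩
      · have := h i _ _ hx3
        rw [add_sub_cancel] at this
        exact Submodule.neg_mem _ this
      · rw [LinearMap.mem_ker, hψ]
        exact add_neg_cancel _
  have := LinearMap.finrank_range_add_finrank_ker ψ
  rw [Module.finrank_prod, hrange, hker, add_comm (Module.finrank K U')] at this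
  unfold submoduleHilbert
  exact_mod_cast this

theorem isHomog_sup_map (h : IsGradedBy ℳ w) {U V : Submodule (MvPolynomial σ K) M}
    (hU : IsHomog ℳ U) (hV : IsHomog ℳ V) (i : σ) :
    IsHomog ℳ (V ⊔ U.map (LinearMap.lsmul (MvPolynomial σ K) M (MvPolynomial.X i))) := by
  intro x hx c
  obtain ⟨v, hv, _, ⟨u, hu, rfl⟩, rfl⟩ := Submodule.mem_sup.1 hx
  rw [map_add]
  refine Submodule.add_mem _ (Submodule.mem_sup_left (hV v hv c)) (Submodule.mem_sup_right ?_)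
  exact ⟨_, hU u hu (c - w i), (h.proj_X_smul' i c u).symm⟩

theorem isHomog_inf_comap (h : IsGradedBy ℳ w) {U V : Submodule (MvPolynomial σ K) M}
    (hU : IsHomog ℳ U) (hV : IsHomog ℳ V) (i : σ) :
    IsHomog ℳ (U ⊓ V.comap (LinearMap.lsmul (MvPolynomial σ K) M (MvPolynomial.X i))) := by
  rintro x ⟨hx1, hx2⟩ c
  refine ⟨hU x hx1 c, ?_⟩
  have := hV _ hx2 (w i + c)
  rwa [LinearMap.lsmul_apply, h.proj_X_smul] at this

/-- The theorem of Hilbert and Serre for subquotients of a multigraded module. -/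
theorem isRationalFunction_submoduleHilbert_sub [Finite σ] [Module.Finite (MvPolynomial σ K) M]
    (h : IsGradedBy ℳ w) (hfin : ∀ c, Module.Finite K (ℳ c)) (l : List σ)
    {U V : Submodule (MvPolynomial σ K) M} (hU : IsHomog ℳ U) (hV : IsHomog ℳ V) (hVU : V ≤ U)
    (hl : ∀ i, i ∉ l → ∀ x ∈ U, (MvPolynomial.X i : MvPolynomial σ K) • x ∈ V) :
    IsRationalFunction (l.map w) fun c => submoduleHilbert ℳ U c - submoduleHilbert ℳ V c := by
  induction l generalizing U V with
  | nil =>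
    -- When every variable maps `U` into `V`, the quotient `U / V` is spanned over `K` by
    -- homogeneous generators of `U`, so it lives in finitely many degrees.
    obtain ⟨Γ, hΓ, hΓU⟩ := exists_homogeneous_generators hU
    refine (Γ.finite_toSet.image Prod.fst).subset ?_
    intro c hc
    by_contra hcΓ
    apply hc
    have key : ∀ x ∈ U, proj ℳ c x ∈ V := by
      intro x hx
      rw [← hΓU] at hx
      induction hx using Submodule.span_induction with
      | mem x hx =>
        obtain ⟨γ, hγ, rfl⟩ := hx
        rw [proj_of_mem_ne (hΓ γ hγ) fun hne => hcΓ ⟨γ, hγ, hne⟩]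
        exact V.zero_mem
      | zero => rw [map_zero]; exact V.zero_mem
      | add x y _ _ hx hy => rw [map_add]; exact V.add_mem hx hy
      | smul r x hx hx' =>
        rw [hΓU] at hx
        induction r using MvPolynomial.induction_on generalizing x with
        | C a =>
          rw [C_smul, map_smul, ← C_smul (σ := σ)]
          exact V.smul_mem _ hx'
        | add p q hp hq =>
          rw [add_smul, map_add]
          exact V.add_mem (hp x hx hx') (hq x hx hx')
        | mul_X p i _ =>
          rw [mul_smul]
          exact hV _ (V.smul_mem _ (hl i (by simp) x hx)) c
    have : V.restrictScalars K ⊓ ℳ c = U.restrictScalars K ⊓ ℳ c := by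
      apply le_antisymm
      · exact inf_le_inf_right _ hVU
      · rintro x ⟨hx1, hx2⟩
        refine ⟨?_, hx2⟩
        have := key x hx1
        rwa [proj_of_mem hx2] at this
    change submoduleHilbert ℳ U c - submoduleHilbert ℳ V c = 0
    rw [submoduleHilbert, submoduleHilbert, this, sub_self]
  | cons i l ih =>
    set μ := LinearMap.lsmul (MvPolynomial σ K) M (MvPolynomial.X i) with hμ
    have hUle : U.map μ ≤ U := by
      rintro _ ⟨x, hx, rfl⟩
      exact U.smul_mem _ hx
    -- The cokernel and the kernel of `Xᵢ` on `U / V` are both killed by `Xᵢ`, so `i` can be dropped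
    -- from the list of variables allowed to act nontrivially.
    have h1 := ih (U := U) (V := V ⊔ U.map μ) hU (isHomog_sup_map h hU hV i)
      (sup_le hVU hUle) (by
        intro j hj x hx
        by_cases hji : j = i
        · subst hji
          exact Submodule.mem_sup_right ⟨x, hx, rfl⟩
        · exact Submodule.mem_sup_left (hl j (by simp [hji, hj]) x hx))
    have h2 := ih (U := U ⊓ V.comap μ) (V := V) (isHomog_inf_comap h hU hV i) hV
      (le_inf hVU fun x hx => V.smul_mem _ hx) (by
        rintro j hj x ⟨hx1, hx2⟩
        by_cases hji : j = i
        · subst hji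
          exact hx2
        · exact hl j (by simp [hji, hj]) x hx1)
    have h3 := h1.sub (h2.shift (w i))
    refine (congrArg (IsRationalFunction (l.map w)) ?_).mp h3
    funext c
    have := submoduleHilbert_step h hfin hU hV i c
    linarith

theorem isRationalFunction_finrank [Finite σ] [Module.Finite (MvPolynomial σ K) M]
    (h : IsGradedBy ℳ w) (hfin : ∀ c, Module.Finite K (ℳ c)) (l : List σ) (hl : ∀ i, i ∈ l) :
    IsRationalFunction (l.map w) fun c => (Module.finrank K (ℳ c) : ℤ) := by
  have := isRationalFunction_submoduleHilbert_sub h hfin l (U := ⊤) (V := ⊥)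
    (fun _ _ _ => trivial) (by
      intro x hx c
      rw [(Submodule.mem_bot _).1 hx, map_zero]
      exact Submodule.zero_mem _) bot_le (fun i hi => absurd (hl i) hi)
  refine (congrArg (IsRationalFunction (l.map w)) ?_).mp this
  funext c
  have h1 : (⊤ : Submodule (MvPolynomial σ K) M).restrictScalars K ⊓ ℳ c = ℳ c := by simp
  have h2 : (⊥ : Submodule (MvPolynomial σ K) M).restrictScalars K ⊓ ℳ c = ⊥ := by simp
  rw [submoduleHilbert, submoduleHilbert, h1, h2, finrank_bot, Nat.cast_zero, sub_zero]

end Graded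

/-! ### Binomial polynomials -/

theorem binomPoly_zero : binomPoly 0 = 1 := by simp [binomPoly]

theorem binomPoly_eval_natCast (r t : ℕ) :
    (binomPoly r).eval (t : ℚ) = ((t + r).choose r : ℕ) := by
  have h : (∏ s ∈ Finset.range r, ((t : ℚ) + ((r : ℚ) - s))) = ((t + r).descFactorial r : ℕ) := by
    rw [Nat.descFactorial_eq_prod_range, Nat.cast_prod]
    refine Finset.prod_congr rfl fun s hs => ?_
    rw [Finset.mem_range] at hs
    rw [Nat.cast_sub (by omega)]
    push_cast
    ring
  have hr : (r.factorial : ℚ) ≠ 0 := by exact_mod_cast r.factorial_ne_zero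
  rw [binomPoly, eval_mul, eval_C, eval_prod]
  simp only [eval_add, eval_X, eval_C]
  rw [h, Nat.descFactorial_eq_factorial_mul_choose]
  push_cast
  field_simp

theorem binomPoly_eval_neg_one (r : ℕ) : (binomPoly (r + 1)).eval (-1 : ℚ) = 0 := by
  rw [binomPoly, eval_mul, eval_prod, Finset.prod_eq_zero (Finset.self_mem_range_succ r), mul_zero]
  simp

theorem natDegree_binomPoly_le (r : ℕ) : (binomPoly r).natDegree ≤ r := by
  unfold binomPoly
  refine (natDegree_C_mul_le _ _).trans ((natDegree_prod_le _ _).trans ?_)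
  rw [Finset.sum_congr rfl fun s _ => natDegree_X_add_C _]
  simp

theorem coeff_binomPoly_self (r : ℕ) : (binomPoly r).coeff r ≠ 0 := by
  unfold binomPoly
  have h : (∏ s ∈ Finset.range r, (X + C ((r : ℚ) - (s : ℚ)))).Monic :=
    monic_prod_of_monic _ _ fun s _ => monic_X_add_C _
  have h2 : (∏ s ∈ Finset.range r, (X + C ((r : ℚ) - (s : ℚ)))).natDegree = r := by
    rw [natDegree_prod_of_monic _ _ fun s _ => monic_X_add_C _]
    rw [Finset.sum_congr rfl fun s _ => natDegree_X_add_C _]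
    simp
  have h3 := h.coeff_natDegree
  rw [h2] at h3
  rw [coeff_C_mul, h3, mul_one]
  exact inv_ne_zero (by exact_mod_cast r.factorial_ne_zero)

/-- The backward difference of a polynomial. -/
def backwardDiff (P : ℚ[X]) : ℚ[X] := P - P.comp (X - C 1)

theorem backwardDiff_eval (P : ℚ[X]) (x : ℚ) :
    (backwardDiff P).eval x = P.eval x - P.eval (x - 1) := by
  simp [backwardDiff]

theorem backwardDiff_sum {ι : Type*} (F : Finset ι) (f : ι → ℚ[X]) :
    backwardDiff (∑ i ∈ F, f i) = ∑ i ∈ F, backwardDiff (f i) := by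
  simp [backwardDiff, Finset.sum_sub_distrib]

theorem backwardDiff_C_mul (a : ℚ) (P : ℚ[X]) :
    backwardDiff (C a * P) = C a * backwardDiff P := by
  simp [backwardDiff, mul_sub]

theorem eq_of_eval_natCast {P Q : ℚ[X]} (h : ∀ n : ℕ, P.eval (n : ℚ) = Q.eval (n : ℚ)) : P = Q := by
  refine eq_of_infinite_eval_eq P Q ?_
  refine Set.Infinite.mono ?_ (Set.infinite_range_of_injective (Nat.cast_injective (R := ℚ)))
  rintro _ ⟨n, rfl⟩
  exact h n

theorem eq_of_eventually_eval_eq {P Q : ℚ[X]}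
    (h : ∀ᶠ x : ℤ in atTop, P.eval (x : ℚ) = Q.eval (x : ℚ)) : P = Q := by
  obtain ⟨x₀, h⟩ := eventually_atTop.1 h
  refine eq_of_infinite_eval_eq P Q ?_
  refine Set.Infinite.mono ?_ ((Set.Ici_infinite x₀).image (Int.cast_injective (α := ℚ)).injOn)
  rintro _ ⟨x, hx, rfl⟩
  exact h x hx

theorem backwardDiff_binomPoly_zero : backwardDiff (binomPoly 0) = 0 := by
  simp [backwardDiff, binomPoly_zero]

theorem backwardDiff_binomPoly_succ (r : ℕ) :
    backwardDiff (binomPoly (r + 1)) = binomPoly r := by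
  have h : (backwardDiff (binomPoly (r + 1))).comp (X + C 1) = (binomPoly r).comp (X + C 1) := by
    refine eq_of_eval_natCast fun n => ?_
    rw [eval_comp, eval_comp, backwardDiff_eval]
    simp only [eval_add, eval_X, eval_C, add_sub_cancel_right]
    have h1 := binomPoly_eval_natCast (r + 1) (n + 1)
    have h2 := binomPoly_eval_natCast (r + 1) n
    have h3 := binomPoly_eval_natCast r (n + 1)
    rw [Nat.cast_add, Nat.cast_one] at h1 h3
    rw [h1, h2, h3, sub_eq_iff_eq_add]
    have : n + 1 + (r + 1) = (n + 1 + r) + 1 := by ring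
    rw [this, Nat.choose_succ_succ', show n + (r + 1) = n + 1 + r by ring]
    push_cast
    ring
  have h2 := congrArg (fun P => P.comp (X - C 1)) h
  simpa [comp_assoc] using h2

theorem eq_zero_of_backwardDiff_eq_zero {P : ℚ[X]} (h : backwardDiff P = 0)
    (h1 : P.eval (-1) = 0) : P = 0 := by
  refine eq_of_eval_natCast fun n => ?_
  have h2 : ∀ x, P.eval x = P.eval (x - 1) := fun x => by
    have := backwardDiff_eval P x
    rw [h, eval_zero] at this
    linarith
  rw [eval_zero]
  induction n with
  | zero => rw [h2]; simpa using h1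
  | succ n ih => rw [h2]; simpa using ih

/-- The polynomial `(x + r - 1 choose r - 1)`, the number of monomials of degree `x` in `r`
variables. -/
def monomialPoly : ℕ → ℚ[X]
  | 0 => 0
  | r + 1 => binomPoly r

theorem backwardDiff_monomialPoly_succ (r : ℕ) :
    backwardDiff (monomialPoly (r + 1)) = monomialPoly r := by
  cases r with
  | zero => exact backwardDiff_binomPoly_zero
  | succ r => exact backwardDiff_binomPoly_succ r

theorem backwardDiff_comp_sub (P : ℚ[X]) (t : ℚ) :
    backwardDiff (P.comp (X - C t)) = (backwardDiff P).comp (X - C t) := by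
  simp only [backwardDiff, sub_comp, comp_assoc, X_comp, C_comp]
  rw [sub_right_comm]

/-- The convolution formula of Vandermonde. -/
theorem monomialPoly_eval_sub (s : ℕ) (t x : ℚ) :
    (monomialPoly s).eval (x - t) = ∑ l ∈ Finset.range s,
      (binomPoly l).eval x * (monomialPoly (s - l)).eval (-1 - t) := by
  have h : ∀ s, (monomialPoly s).comp (X - C t) - ∑ l ∈ Finset.range s,
      C ((monomialPoly (s - l)).eval (-1 - t)) * binomPoly l = 0 := by
    intro s
    induction s with
    | zero => simp [monomialPoly]
    | succ s ih =>
      -- Differencing reduces `s + 1` to `s`. The remaining constant is fixed by evaluation at `-1`,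
      -- where every `binomPoly` except the one of index `0` vanishes.
      apply eq_zero_of_backwardDiff_eq_zero
      · have : ∀ P Q : ℚ[X], backwardDiff (P - Q) = backwardDiff P - backwardDiff Q := by
          intro P Q
          simp only [backwardDiff, sub_comp]
          ring
        rw [this, backwardDiff_comp_sub, backwardDiff_monomialPoly_succ, backwardDiff_sum,
          Finset.sum_range_succ', backwardDiff_C_mul, backwardDiff_binomPoly_zero, mul_zero,
          add_zero, ← ih]
        congr 1
        refine Finset.sum_congr rfl fun l _ => ?_
        rw [backwardDiff_C_mul, backwardDiff_binomPoly_succ, Nat.add_sub_add_right]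
      · rw [eval_sub, eval_finsetSum, Finset.sum_range_succ', Finset.sum_eq_zero]
        · simp [binomPoly_zero]
        · intro l _
          rw [eval_mul, binomPoly_eval_neg_one, mul_zero]
  have h' := congrArg (fun P => P.eval x) (sub_eq_zero.1 (h s))
  simp only [eval_comp, eval_sub, eval_X, eval_C, eval_finsetSum, eval_mul] at h'
  rw [h']
  exact Finset.sum_congr rfl fun l _ => mul_comm _ _

theorem backwardDiff_sum_binomPoly (R : ℕ) (c : ℕ → ℚ) :
    backwardDiff (∑ l ∈ Finset.range (R + 1), C (c l) * binomPoly l) =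
      ∑ l ∈ Finset.range R, C (c (l + 1)) * binomPoly l := by
  rw [backwardDiff_sum, Finset.sum_range_succ', backwardDiff_C_mul, backwardDiff_binomPoly_zero,
    mul_zero, add_zero]
  refine Finset.sum_congr rfl fun l _ => ?_
  rw [backwardDiff_C_mul, backwardDiff_binomPoly_succ]

theorem coeff_eq_of_sum_binomPoly_eq {R : ℕ} {c d : ℕ → ℚ}
    (h : ∑ l ∈ Finset.range R, C (c l) * binomPoly l =
      ∑ l ∈ Finset.range R, C (d l) * binomPoly l) : ∀ l < R, c l = d l := by
  induction R generalizing c d with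
  | zero => simp
  | succ R ih =>
    have h1 := congrArg backwardDiff h
    rw [backwardDiff_sum_binomPoly, backwardDiff_sum_binomPoly] at h1
    have h2 := ih (c := fun l => c (l + 1)) (d := fun l => d (l + 1)) h1
    intro l hl
    cases l with
    | succ l => exact h2 l (by omega)
    | zero =>
      have h3 : ∑ l ∈ Finset.range R, C (c (l + 1)) * binomPoly (l + 1) =
          ∑ l ∈ Finset.range R, C (d (l + 1)) * binomPoly (l + 1) :=
        Finset.sum_congr rfl fun l hl => by rw [h2 l (Finset.mem_range.1 hl)]
      rw [Finset.sum_range_succ', Finset.sum_range_succ', h3, binomPoly_zero, mul_one,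
        mul_one] at h
      exact C_injective (add_left_cancel h)

theorem binomPoly_eval_int (r : ℕ) {x : ℤ} (hx : 0 ≤ x) :
    ∃ z : ℤ, (binomPoly r).eval (x : ℚ) = z := by
  lift x to ℕ using hx
  exact ⟨_, binomPoly_eval_natCast r x⟩

/-- Backward differences preserve integrality of values and shift the binomial coefficients down by
one; the constant term is then an integral value minus integers. This is why the Hilbert
coefficients are integers. -/
theorem integral_of_eventually_integral {R : ℕ} {c : ℕ → ℚ}
    (h : ∀ᶠ x : ℤ in atTop, ∃ z : ℤ,
      (∑ l ∈ Finset.range R, C (c l) * binomPoly l).eval (x : ℚ) = z) :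
    ∀ l < R, ∃ z : ℤ, c l = z := by
  induction R generalizing c with
  | zero => simp
  | succ R ih =>
    have h1 : ∀ l < R, ∃ z : ℤ, c (l + 1) = z := by
      refine ih (c := fun l => c (l + 1)) ?_
      have h' : ∀ᶠ x : ℤ in atTop, ∃ z : ℤ,
          (∑ l ∈ Finset.range (R + 1), C (c l) * binomPoly l).eval ((x - 1 : ℤ) : ℚ) = z :=
        (tendsto_atTop_add_const_right atTop (-1 : ℤ) tendsto_id).eventually h
      filter_upwards [h, h'] with x ⟨z, hz⟩ ⟨z', hz'⟩
      refine ⟨z - z', ?_⟩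
      rw [← backwardDiff_sum_binomPoly, backwardDiff_eval, hz]
      push_cast at hz' ⊢
      rw [hz']
    intro l hl
    cases l with
    | succ l => exact h1 l (by omega)
    | zero =>
      obtain ⟨x, ⟨z, hz⟩, hx⟩ := (h.and (eventually_ge_atTop 0)).exists
      choose! e he using h1
      choose f hf using fun r => binomPoly_eval_int r hx
      refine ⟨z - ∑ l ∈ Finset.range R, e l * f (l + 1), ?_⟩
      rw [Finset.sum_range_succ', eval_add, eval_finsetSum, binomPoly_zero, mul_one, eval_C,
        add_comm] at hz
      push_cast
      rw [← hz, eq_comm, sub_eq_iff_eq_add, add_right_inj]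
      refine Finset.sum_congr rfl fun l hl => ?_
      rw [eval_mul, eval_C, hf, he l (Finset.mem_range.1 hl)]

theorem natDegree_le_of_growth {P : ℚ[X]} {d : ℕ} {A : ℚ}
    (h : ∀ᶠ x : ℕ in atTop, |P.eval (x : ℚ)| ≤ A * ((x : ℚ) + 1) ^ d) : P.natDegree ≤ d := by
  by_contra! hd
  have hdeg : ((X + C (1 : ℚ)) ^ d).degree < P.degree := by
    rw [degree_pow, degree_X_add_C, degree_eq_natDegree (by rintro rfl; simp at hd)]
    simpa using hd
  have h1 := abs_div_tendsto_atTop_atTop_of_degree_gt P _ hdeg (pow_ne_zero _ (X_add_C_ne_zero 1))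
  have h2 := (h1.comp (tendsto_natCast_atTop_atTop (R := ℚ))).eventually (eventually_gt_atTop A)
  obtain ⟨x, hx1, hx2⟩ := (h.and h2).exists
  have hpos : (0 : ℚ) < ((x : ℚ) + 1) ^ d := by positivity
  simp only [Function.comp_apply, eval_pow, eval_add, eval_X, eval_C] at hx2
  rw [abs_div, abs_of_pos hpos, lt_div_iff₀ hpos] at hx2
  linarith

theorem coeff_eq_zero_of_natDegree_sum_binomPoly_le {R d : ℕ} {c : ℕ → ℚ}
    (h : (∑ l ∈ Finset.range R, C (c l) * binomPoly l).natDegree ≤ d) :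
    ∀ l < R, d < l → c l = 0 := by
  induction R with
  | zero => simp
  | succ R ih =>
    intro l hl hdl
    have h1 : c R = 0 := by
      have h2 := coeff_eq_zero_of_natDegree_lt (h.trans_lt (hdl.trans_le (Nat.lt_succ_iff.1 hl)))
      rw [Finset.sum_range_succ, coeff_add, finsetSum_coeff, Finset.sum_eq_zero, zero_add,
        coeff_C_mul] at h2
      · exact (mul_eq_zero.1 h2).resolve_right (coeff_binomPoly_self R)
      · intro j hj
        rw [coeff_C_mul, coeff_eq_zero_of_natDegree_lt, mul_zero]
        exact (natDegree_binomPoly_le j).trans_lt (Finset.mem_range.1 hj)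
    rcases (Nat.lt_succ_iff.1 hl).eq_or_lt with rfl | hl'
    · exact h1
    · refine ih ?_ l hl' hdl
      rwa [Finset.sum_range_succ, h1, C_0, zero_mul, add_zero] at h

/-- Leading terms cancel. The coefficientwise form expresses "degree less than `d`" uniformly,
including `d = 0`, where the difference is zero. -/
theorem coeff_backwardDiff_eq_zero {P : ℚ[X]} {d : ℕ} (h : P.natDegree ≤ d) {t : ℕ} (ht : d ≤ t) :
    (backwardDiff P).coeff t = 0 := by
  rcases Nat.eq_zero_or_pos P.natDegree with h0 | h0
  · rw [eq_C_of_natDegree_eq_zero h0]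
    simp [backwardDiff]
  · have hP : P ≠ 0 := by rintro rfl; simp at h0
    have h1 : (P.comp (X - C 1)).natDegree = P.natDegree := by
      rw [natDegree_comp, natDegree_X_sub_C, mul_one]
    have h2 : P.comp (X - C 1) ≠ 0 := by
      intro h2
      rw [h2] at h1
      simp at h1
      omega
    apply coeff_eq_zero_of_degree_lt
    refine lt_of_lt_of_le (degree_sub_lt_left ?_ hP ?_) ((degree_le_natDegree).trans ?_)
    · rw [degree_eq_natDegree hP, degree_eq_natDegree h2, h1]
    · rw [leadingCoeff_comp (by rw [natDegree_X_sub_C]; exact one_ne_zero), leadingCoeff_X_sub_C,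
        one_pow, mul_one]
    · exact_mod_cast h.trans ht

/-! ### Counting monomials -/

/-- The number of monomials of degree `t` in `r` variables. -/
def monomialCount (r : ℕ) (t : ℤ) : ℤ := if 0 ≤ t then (Nat.multichoose r t.toNat : ℤ) else 0

theorem monomialCount_of_neg (r : ℕ) {t : ℤ} (h : t < 0) : monomialCount r t = 0 :=
  if_neg (by omega)

theorem monomialCount_zero (t : ℤ) : monomialCount 0 t = if t = 0 then 1 else 0 := by
  unfold monomialCount
  rcases lt_trichotomy t 0 with h | rfl | h
  · rw [if_neg (by omega), if_neg (by omega)]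
  · simp
  · rw [if_pos h.le, if_neg h.ne']
    obtain ⟨k, hk⟩ : ∃ k, t.toNat = k + 1 := ⟨t.toNat - 1, by omega⟩
    rw [hk, Nat.multichoose_zero_succ, Nat.cast_zero]

theorem monomialCount_sub (r : ℕ) (t : ℤ) :
    monomialCount (r + 1) t - monomialCount (r + 1) (t - 1) = monomialCount r t := by
  unfold monomialCount
  rcases lt_trichotomy t 0 with h | rfl | h
  · rw [if_neg (by omega), if_neg (by omega), if_neg (by omega), sub_zero]
  · simp
  · rw [if_pos h.le, if_pos (by omega), if_pos h.le]
    obtain ⟨k, hk⟩ : ∃ k, t.toNat = k + 1 := ⟨t.toNat - 1, by omega⟩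
    have hk' : (t - 1).toNat = k := by omega
    rw [hk, hk', Nat.multichoose_succ_succ]
    push_cast
    ring

/-- Strict positivity matters: for `r = 0` and `t = 0` the count is `1` while the polynomial is `0`.
This is the reason for the strict bounds in `exists_lt_fst_snd`. -/
theorem monomialCount_eq (r : ℕ) {t : ℤ} (h : 0 < t) :
    (monomialCount r t : ℚ) = (monomialPoly r).eval (t : ℚ) := by
  cases r with
  | zero => rw [monomialCount_zero, if_neg h.ne']; simp [monomialPoly]
  | succ r =>
    lift t to ℕ using h.le
    rw [monomialPoly, monomialCount, if_pos h.le, Int.toNat_natCast, Nat.multichoose_eq,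
      Int.cast_natCast, Int.cast_natCast, binomPoly_eval_natCast]
    rw [show r + 1 + t - 1 = t + r by omega, ← Nat.choose_symm_add]

theorem sum_Icc_eq_of_sub {f g : ℤ → ℤ} {t₀ : ℤ} (hf : ∀ t < t₀, f t = 0)
    (h : ∀ t, f t - f (t - 1) = g t) (x : ℤ) : ∑ y ∈ Finset.Icc t₀ x, g y = f x := by
  rcases lt_or_ge x t₀ with hx | hx
  · rw [hf x hx, Finset.Icc_eq_empty (by omega), Finset.sum_empty]
  · induction x, hx using Int.leInduction with
    | base =>
      rw [Finset.Icc_self, Finset.sum_singleton, ← h, hf (t₀ - 1) (by omega), sub_zero]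
    | succ x hx ih =>
      have : Finset.Icc t₀ (x + 1) = insert (x + 1) (Finset.Icc t₀ x) := by
        ext y
        simp only [Finset.mem_Icc, Finset.mem_insert]
        omega
      rw [this, Finset.sum_insert (by simp), ih, ← h, add_sub_cancel_right, sub_add_cancel]

theorem finsum_Iic_eq_of_sub {f g : ℤ → ℤ} {t₀ : ℤ} (hf : ∀ t < t₀, f t = 0)
    (h : ∀ t, f t - f (t - 1) = g t) (x : ℤ) : ∑ᶠ y ∈ Set.Iic x, g y = f x := by
  rw [← sum_Icc_eq_of_sub hf h x]
  refine finsum_mem_eq_sum_of_inter_support_eq _ ?_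
  ext y
  simp only [Set.mem_inter_iff, Set.mem_Iic, Function.mem_support, Finset.coe_Icc, Set.mem_Icc]
  constructor
  · rintro ⟨h1, h2⟩
    refine ⟨⟨?_, h1⟩, h2⟩
    by_contra! hy
    rw [← h, hf y hy, hf (y - 1) (by omega)] at h2
    exact h2 rfl
  · rintro ⟨⟨_, h1⟩, h2⟩
    exact ⟨h1, h2⟩

theorem eq_of_sub_eq {f g : ℤ → ℤ} {t₀ : ℤ} (hf : ∀ t < t₀, f t = 0) (hg : ∀ t < t₀, g t = 0)
    (h : ∀ t, f t - f (t - 1) = g t - g (t - 1)) : f = g := by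
  funext x
  rw [← sum_Icc_eq_of_sub hf (fun _ => rfl), ← sum_Icc_eq_of_sub hg (fun _ => rfl)]
  exact Finset.sum_congr rfl fun y _ => h y

/-- The coefficients of the rational function with numerator `∑ c_w s^{w_1} t^{w_2}` and
denominator `(1 - s)^r (1 - t)^q`. -/
def rationalCoeff (W : Finset (ℤ × ℤ)) (c : ℤ × ℤ → ℤ) (r q : ℕ) (a k : ℤ) : ℤ :=
  ∑ w ∈ W, c w * monomialCount r (a - w.1) * monomialCount q (k - w.2)

section rationalCoeff

variable (W : Finset (ℤ × ℤ)) (c : ℤ × ℤ → ℤ)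

theorem rationalCoeff_sub_left (r q : ℕ) (a k : ℤ) :
    rationalCoeff W c (r + 1) q a k - rationalCoeff W c (r + 1) q (a - 1) k =
      rationalCoeff W c r q a k := by
  unfold rationalCoeff
  rw [← Finset.sum_sub_distrib]
  refine Finset.sum_congr rfl fun w _ => ?_
  rw [← monomialCount_sub r, sub_right_comm a 1]
  ring

theorem rationalCoeff_sub_right (r q : ℕ) (a k : ℤ) :
    rationalCoeff W c r (q + 1) a k - rationalCoeff W c r (q + 1) a (k - 1) =
      rationalCoeff W c r q a k := by
  unfold rationalCoeff
  rw [← Finset.sum_sub_distrib]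
  refine Finset.sum_congr rfl fun w _ => ?_
  rw [← monomialCount_sub q, sub_right_comm k 1]
  ring

theorem exists_rationalCoeff_eq_zero : ∃ t₀ : ℤ, ∀ r q a k, (a < t₀ ∨ k < t₀) →
    rationalCoeff W c r q a k = 0 := by
  obtain ⟨b, hb⟩ := (W.image fun w => min w.1 w.2).bddBelow
  refine ⟨b, fun r q a k h => Finset.sum_eq_zero fun w hw => ?_⟩
  have h1 := hb (Finset.mem_coe.2 (Finset.mem_image_of_mem _ hw))
  rcases h with h | h
  · rw [monomialCount_of_neg _ (by omega : a - w.1 < 0), mul_zero, zero_mul]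
  · rw [monomialCount_of_neg _ (by omega : k - w.2 < 0), mul_zero]

end rationalCoeff

/-- In the coordinates `(a, k)` the degrees `(1, 0)` and `(p, 1)` become the unit vectors, and each
difference is a multiplication by `1 - s` or `1 - t`. It can be undone uniquely among functions
vanishing in small degrees, by `eq_of_sub_eq`. -/
theorem exists_eq_rationalCoeff (p : ℤ) (n m : ℕ) (f : ℤ × ℤ → ℤ) (t₀ : ℤ)
    (hf0 : ∀ a k, (a < t₀ ∨ k < t₀) → f (a + p * k, k) = 0)
    (hf : IsRationalFunction (List.replicate n (1, 0) ++ List.replicate m (p, 1)) f) :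
    ∃ W c, ∀ a k, f (a + p * k, k) = rationalCoeff W c n m a k := by
  induction n generalizing f t₀ with
  | succ n ih =>
    obtain ⟨W, c, h⟩ := ih (fun e => f e - f (e - (1, 0))) t₀ (by
      intro a k h
      have h1 := hf0 a k h
      have h2 := hf0 (a - 1) k (by omega)
      rw [Prod.mk_sub_mk, sub_zero, h1, show a + p * k - 1 = a - 1 + p * k by ring, h2,
        sub_zero]) hf
    refine ⟨W, c, fun a k => ?_⟩
    obtain ⟨t₁, ht₁⟩ := exists_rationalCoeff_eq_zero W c
    have := eq_of_sub_eq (f := fun a => f (a + p * k, k))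
      (g := fun a => rationalCoeff W c (n + 1) m a k) (t₀ := min t₀ t₁)
      (fun t ht => hf0 t k (Or.inl (by omega))) (fun t ht => ht₁ _ _ _ _ (Or.inl (by omega)))
      (fun t => by
        rw [rationalCoeff_sub_left, ← h]
        rw [Prod.mk_sub_mk, sub_zero, show t + p * k - 1 = t - 1 + p * k by ring])
    exact congrFun this a
  | zero =>
    rw [List.replicate_zero, List.nil_append] at hf
    induction m generalizing f t₀ with
    | zero =>
      have hf : (Function.support f).Finite := hf
      have hinj : Function.Injective fun e : ℤ × ℤ => (e.1 + p * e.2, e.2) := by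
        rintro ⟨a, b⟩ ⟨a', b'⟩ h
        simp only [Prod.mk.injEq] at h
        obtain ⟨h1, rfl⟩ := h
        simpa using h1
      -- Without denominators `monomialCount 0` is a Kronecker delta, so the numerator is `f`
      -- itself, regraded.
      refine ⟨(hf.preimage hinj.injOn).toFinset, fun e => f (e.1 + p * e.2, e.2), fun a k => ?_⟩
      unfold rationalCoeff
      rw [Finset.sum_eq_single (a, k)]
      · simp [monomialCount_zero]
      · rintro ⟨a', k'⟩ _ hne
        rw [monomialCount_zero, monomialCount_zero]
        dsimp only
        split_ifs with h1 h2
        · exact absurd (Prod.ext (by dsimp only; omega) (by dsimp only; omega)) hne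
        all_goals simp
      · intro h
        have : f (a + p * k, k) = 0 := by simpa using h
        simp [this]
    | succ m ih =>
      obtain ⟨W, c, h⟩ := ih (fun e => f e - f (e - (p, 1))) t₀ (by
        intro a k h
        have h1 := hf0 a k h
        have h2 := hf0 a (k - 1) (by omega)
        rw [Prod.mk_sub_mk, h1, show a + p * k - p = a + p * (k - 1) by ring, h2, sub_zero]) hf
      refine ⟨W, c, fun a k => ?_⟩
      obtain ⟨t₁, ht₁⟩ := exists_rationalCoeff_eq_zero W c
      have := eq_of_sub_eq (f := fun k => f (a + p * k, k))
        (g := fun k => rationalCoeff W c 0 (m + 1) a k) (t₀ := min t₀ t₁)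
        (fun t ht => hf0 a t (Or.inr (by omega))) (fun t ht => ht₁ _ _ _ _ (Or.inr (by omega)))
        (fun t => by
          rw [rationalCoeff_sub_right, ← h]
          rw [Prod.mk_sub_mk, show a + p * t - p = a + p * (t - 1) by ring])
      exact congrFun this k

/-- The coefficient of `binomPoly l` in the polynomial of `rationalCoeff W c (s + l) q`. -/
def coeffPoly (W : Finset (ℤ × ℤ)) (c : ℤ × ℤ → ℤ) (q s : ℕ) : ℚ[X] :=
  ∑ w ∈ W, C ((c w : ℚ) * (monomialPoly s).eval (-1 - (w.1 : ℚ))) *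
    (monomialPoly q).comp (X - C (w.2 : ℚ))

/-! ### Separation of the two variables and consequences of growth bounds -/

section coeffPoly

variable (W : Finset (ℤ × ℤ)) (c : ℤ × ℤ → ℤ)

theorem coeffPoly_zero (q : ℕ) : coeffPoly W c q 0 = 0 := by
  simp [coeffPoly, monomialPoly]

theorem exists_lt_fst_snd : ∃ b : ℤ, ∀ w ∈ W, w.1 < b ∧ w.2 < b := by
  obtain ⟨b, hb⟩ := (W.image fun w => max w.1 w.2).bddAbove
  refine ⟨b + 1, fun w hw => ?_⟩
  have h1 := hb (Finset.mem_coe.2 (Finset.mem_image_of_mem _ hw))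
  omega

variable {W} {b : ℤ}

theorem rationalCoeff_eq_sum (hb : ∀ w ∈ W, w.1 < b ∧ w.2 < b) (r q : ℕ) {a k : ℤ}
    (ha : b ≤ a) (hk : b ≤ k) :
    (rationalCoeff W c r q a k : ℚ) = ∑ l ∈ Finset.range r,
      (binomPoly l).eval (a : ℚ) * (coeffPoly W c q (r - l)).eval (k : ℚ) := by
  unfold rationalCoeff coeffPoly
  push_cast
  simp only [eval_finsetSum, Finset.mul_sum]
  rw [Finset.sum_comm]
  refine Finset.sum_congr rfl fun w hw => ?_
  have := hb w hw
  rw [monomialCount_eq _ (by omega), monomialCount_eq _ (by omega)]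
  push_cast
  rw [monomialPoly_eval_sub r, Finset.mul_sum, Finset.sum_mul]
  refine Finset.sum_congr rfl fun l _ => ?_
  simp only [eval_mul, eval_C, eval_comp, eval_sub, eval_X]
  ring

/-- If the rows of `rationalCoeff` grow at most like `x ^ d`, the leading coefficients vanish. -/
theorem coeffPoly_eval_eq_zero (hb : ∀ w ∈ W, w.1 < b ∧ w.2 < b) (r q d : ℕ) {k : ℤ}
    (hk : b ≤ k) {A : ℚ}
    (h : ∀ᶠ a : ℕ in atTop, |(rationalCoeff W c r q a k : ℚ)| ≤ A * ((a : ℚ) + 1) ^ d) (l : ℕ)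
    (hdl : d < l) : (coeffPoly W c q (r - l)).eval (k : ℚ) = 0 := by
  rcases lt_or_ge l r with hl | hl
  · refine coeff_eq_zero_of_natDegree_sum_binomPoly_le (R := r) (d := d)
      (c := fun l => (coeffPoly W c q (r - l)).eval (k : ℚ)) (natDegree_le_of_growth (A := A) ?_)
      l hl hdl
    filter_upwards [h, eventually_ge_atTop b.toNat] with a ha hab
    rw [rationalCoeff_eq_sum c hb r q (by omega) hk] at ha
    rw [eval_finsetSum]
    refine le_trans (le_of_eq ?_) ha
    congr 1
    refine Finset.sum_congr rfl fun l _ => ?_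
    rw [eval_mul, eval_C, mul_comm, Int.cast_natCast]
  · rw [Nat.sub_eq_zero_of_le hl, coeffPoly_zero, eval_zero]

/-- If the columns of `rationalCoeff` grow at most like `x ^ d`, the polynomials `coeffPoly` have
degree less than `d`. -/
theorem coeff_coeffPoly_eq_zero (hb : ∀ w ∈ W, w.1 < b ∧ w.2 < b) (q d r : ℕ)
    (h : ∀ a : ℤ, ∃ A : ℚ, ∀ᶠ k : ℕ in atTop,
      |(rationalCoeff W c r (q + 1) a k : ℚ)| ≤ A * ((k : ℚ) + 1) ^ d) {s : ℕ} (hs : s ≤ r)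
    {t : ℕ} (ht : d ≤ t) : (coeffPoly W c q s).coeff t = 0 := by
  obtain ⟨l, rfl⟩ := Nat.exists_eq_add_of_le hs
  rcases Nat.eq_zero_or_pos s with rfl | hs'
  · rw [coeffPoly_zero, coeff_zero]
  -- For fixed `a` the partial sums over `k` are eventually a polynomial in `k` of degree at most
  -- `d`; differencing brings `q + 1` down to `q` and the degree below `d`. The coefficient of `k ^
  -- t` is thus a combination of the `binomPoly l' (a)` that vanishes for all large `a`, and linear
  -- independence kills each summand.
  have key : ∀ a : ℤ, b ≤ a → (∑ l' ∈ Finset.range (s + l),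
      C ((coeffPoly W c q (s + l - l')).coeff t) * binomPoly l').eval (a : ℚ) = 0 := by
    intro a ha
    obtain ⟨A, hA⟩ := h a
    have hS : ∀ q (k : ℤ), b ≤ k → (∑ l' ∈ Finset.range (s + l),
        C ((binomPoly l').eval (a : ℚ)) * coeffPoly W c q (s + l - l')).eval (k : ℚ) =
        rationalCoeff W c (s + l) q a k := by
      intro q k hk
      rw [rationalCoeff_eq_sum c hb _ _ ha hk, eval_finsetSum]
      exact Finset.sum_congr rfl fun l _ => by rw [eval_mul, eval_C]
    have h1 := natDegree_le_of_growth (P := ∑ l' ∈ Finset.range (s + l),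
        C ((binomPoly l').eval (a : ℚ)) * coeffPoly W c (q + 1) (s + l - l')) (d := d) (A := A) (by
      filter_upwards [hA, eventually_ge_atTop b.toNat] with k hk hbk
      have := hS (q + 1) k (by omega)
      rw [Int.cast_natCast] at this
      rwa [this])
    have h2 := coeff_backwardDiff_eq_zero h1 ht
    have h3 : backwardDiff (∑ l' ∈ Finset.range (s + l),
        C ((binomPoly l').eval (a : ℚ)) * coeffPoly W c (q + 1) (s + l - l')) =
        ∑ l' ∈ Finset.range (s + l),
        C ((binomPoly l').eval (a : ℚ)) * coeffPoly W c q (s + l - l') := by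
      rw [backwardDiff_sum]
      refine Finset.sum_congr rfl fun l' _ => ?_
      rw [backwardDiff_C_mul]
      unfold coeffPoly
      rw [backwardDiff_sum]
      congr 1
      refine Finset.sum_congr rfl fun w _ => ?_
      rw [backwardDiff_C_mul, backwardDiff_comp_sub, backwardDiff_monomialPoly_succ]
    rw [h3, finsetSum_coeff] at h2
    rw [eval_finsetSum, ← h2]
    refine Finset.sum_congr rfl fun l' _ => ?_
    rw [eval_mul, eval_C, coeff_C_mul, mul_comm]
  have h4 := coeff_eq_of_sum_binomPoly_eq (R := s + l) (d := fun _ => 0)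
    (c := fun l' => (coeffPoly W c q (s + l - l')).coeff t) (by
      refine eq_of_eventually_eval_eq ?_
      filter_upwards [eventually_ge_atTop b] with a ha
      rw [key a ha]
      simp) l (by omega)
  rwa [Nat.add_sub_cancel] at h4

end coeffPoly

/-! ### Bigraded modules -/

/-- An ideal and its powers have the same zero locus. Growth in `M / 𝔪 ^ s M` is therefore governed
by `dim M / 𝔪 M`, whatever `s` is. -/
theorem supportNatDim_quotient_pow {R : Type*} [CommRing R] {M : Type*} [AddCommGroup M]
    [Module R M] [Module.Finite R M] (I : Ideal R) {s : ℕ} (hs : s ≠ 0) :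
    supportNatDim R (M ⧸ (I ^ s • (⊤ : Submodule R M))) =
      supportNatDim R (M ⧸ (I • (⊤ : Submodule R M))) := by
  unfold supportNatDim Module.supportDim
  rw [Module.support_quotient, Module.support_quotient, PrimeSpectrum.zeroLocus_pow I hs]

section Monomials

variable {n m : ℕ}

/-- The exponents of the variables `xᵢ`. -/
def exponentX (α : Fin n ⊕ Fin m →₀ ℕ) : Fin n →₀ ℕ := α.comapDomain Sum.inl Sum.inl_injective.injOn

/-- The exponents of the variables `yⱼ`. -/
def exponentY (α : Fin n ⊕ Fin m →₀ ℕ) : Fin m →₀ ℕ := α.comapDomain Sum.inr Sum.inr_injective.injOn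

theorem mapDomain_exponent_add (α : Fin n ⊕ Fin m →₀ ℕ) :
    (exponentX α).mapDomain Sum.inl + (exponentY α).mapDomain Sum.inr = α := by
  ext i
  rw [Finsupp.add_apply]
  rcases i with i | i
  · rw [Finsupp.mapDomain_apply Sum.inl_injective, Finsupp.mapDomain_of_notMem_range _ _ (by simp)]
    rfl
  · rw [Finsupp.mapDomain_apply Sum.inr_injective, Finsupp.mapDomain_of_notMem_range _ _ (by simp)]
    exact zero_add _

theorem monomial_eq_inclX_mul {K : Type*} [Field K] (α : Fin n ⊕ Fin m →₀ ℕ) :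
    MvPolynomial.monomial α (1 : K) = inclX K n m (MvPolynomial.monomial (exponentX α) 1) *
      MvPolynomial.rename Sum.inr (MvPolynomial.monomial (exponentY α) 1) := by
  rw [inclX, MvPolynomial.rename_monomial, MvPolynomial.rename_monomial,
    MvPolynomial.monomial_mul, one_mul, mapDomain_exponent_add]

theorem degree_eq_add (α : Fin n ⊕ Fin m →₀ ℕ) :
    α.degree = (exponentX α).degree + (exponentY α).degree := by
  rw [Finsupp.degree_eq_sum, Finsupp.degree_eq_sum, Finsupp.degree_eq_sum, Fintype.sum_sum_type]
  rfl

/-- Equality of the `p t` is what makes the bidegree depend only on the total `x`- and `y`-degrees,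
so that `i - p₀ * k` recovers the `x`-degree. -/
theorem weight_bidegree {p : Fin m → ℕ} {p₀ : ℕ} (hp : ∀ t, p t = p₀)
    (α : Fin n ⊕ Fin m →₀ ℕ) : Finsupp.weight (bidegree n p) α =
      (((exponentX α).degree + p₀ * (exponentY α).degree : ℤ), ((exponentY α).degree : ℤ)) := by
  rw [Finsupp.weight_apply, Finsupp.sum_fintype _ _ (by simp), Fintype.sum_sum_type,
    Finsupp.degree_eq_sum, Finsupp.degree_eq_sum]
  refine Prod.ext ?_ ?_
  · simp [bidegree, hp, Prod.fst_sum, exponentX, exponentY, Finset.mul_sum, mul_comm]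
  · simp [bidegree, Prod.snd_sum, exponentY]

end Monomials

/-! ### Growth of a bigraded module along rows and columns -/

section Bigraded

variable {K : Type*} [Field K] {n m : ℕ} {p : Fin m → ℕ} {p₀ : ℕ}
  {M : Type*} [AddCommGroup M] [Module K M] [Module (PolyXY K n m) M]
  [IsScalarTower K (PolyXY K n m) M]
  {ℳ : ℤ × ℤ → Submodule K M} [DirectSum.Decomposition ℳ]
  [SetLike.GradedSMul (bigrading K n p) ℳ]

variable (n p ℳ) in
theorem isGradedBy_bidegree : IsGradedBy ℳ (bidegree n p) := fun i c x hx => by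
  have h1 : (MvPolynomial.X i : PolyXY K n m) ∈ bigrading K n p (bidegree n p i) :=
    MvPolynomial.isWeightedHomogeneous_X K (bidegree n p) i
  exact SetLike.GradedSMul.smul_mem h1 hx

variable (n m p₀ ℳ) in
/-- A finite set of homogeneous generators of a bigraded module whose regraded degrees are bounded
below by `-b` and whose second degrees are bounded above by `b`. -/
structure IsGenerators (Γ : Finset ((ℤ × ℤ) × M)) (b : ℕ) : Prop where
  mem : ∀ γ ∈ Γ, γ.2 ∈ ℳ γ.1
  span : Submodule.span (PolyXY K n m) (Prod.snd '' (Γ : Set ((ℤ × ℤ) × M))) = ⊤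
  fst_ge : ∀ γ ∈ Γ, -(b : ℤ) ≤ γ.1.1 - p₀ * γ.1.2
  snd_ge : ∀ γ ∈ Γ, -(b : ℤ) ≤ γ.1.2
  snd_le : ∀ γ ∈ Γ, γ.1.2 ≤ b

variable (n m p₀ ℳ) in
theorem exists_isGenerators [Module.Finite (PolyXY K n m) M] :
    ∃ Γ b, IsGenerators n m p₀ ℳ Γ b := by
  obtain ⟨Γ, h1, h2⟩ := exists_homogeneous_generators (σ := Fin n ⊕ Fin m) (ℳ := ℳ) (U := ⊤)
    fun _ _ _ => trivial
  obtain ⟨b, hb⟩ := (Γ.image fun γ =>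
    (γ.1.1 - (p₀ : ℤ) * γ.1.2).natAbs + γ.1.2.natAbs).bddAbove
  have hb' : ∀ γ ∈ Γ, (γ.1.1 - (p₀ : ℤ) * γ.1.2).natAbs + γ.1.2.natAbs ≤ b := fun γ hγ =>
    hb (Finset.mem_coe.2 (Finset.mem_image_of_mem _ hγ))
  refine ⟨Γ, b, h1, h2, ?_, ?_, ?_⟩
  all_goals
    intro γ hγ
    have := hb' γ hγ
    omega

variable {Γ : Finset ((ℤ × ℤ) × M)} {b : ℕ}

theorem IsGenerators.le_span (hΓ : IsGenerators n m p₀ ℳ Γ b) (hp : ∀ t, p t = p₀) (a k : ℤ) :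
    ℳ (a + p₀ * k, k) ≤ Submodule.span K {x | ∃ α : Fin n ⊕ Fin m →₀ ℕ, ∃ γ ∈ Γ,
      ((exponentX α).degree : ℤ) = a - (γ.1.1 - p₀ * γ.1.2) ∧
      ((exponentY α).degree : ℤ) = k - γ.1.2 ∧ x = MvPolynomial.monomial α (1 : K) • γ.2} := by
  refine ((isGradedBy_bidegree n p ℳ).le_span hΓ.mem hΓ.span _).trans (Submodule.span_mono ?_)
  rintro x ⟨α, γ, hγ, h, rfl⟩
  rw [weight_bidegree hp] at h
  have h1 := congrArg Prod.fst h
  have h2 := congrArg Prod.snd h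
  simp only [Prod.fst_add, Prod.snd_add] at h1 h2
  refine ⟨α, γ, hγ, ?_, by omega, rfl⟩
  rw [← h2] at h1
  linarith

theorem IsGenerators.eq_bot (hΓ : IsGenerators n m p₀ ℳ Γ b) (hp : ∀ t, p t = p₀) {a k : ℤ}
    (h : a < -(b : ℤ) ∨ k < -(b : ℤ)) : ℳ (a + p₀ * k, k) = ⊥ := by
  rw [eq_bot_iff]
  refine (hΓ.le_span hp a k).trans ?_
  rw [Submodule.span_le]
  rintro x ⟨α, γ, hγ, h1, h2, -⟩
  have := hΓ.fst_ge γ hγ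
  have := hΓ.snd_ge γ hγ
  omega

open Classical in
theorem IsGenerators.le_growthSpan (hΓ : IsGenerators n m p₀ ℳ Γ b) (hp : ∀ t, p t = p₀) {a k : ℤ}
    {x : ℕ} (h : a + k + 2 * b ≤ x) :
    ℳ (a + p₀ * k, k) ≤ growthSpan K (σ := Fin n ⊕ Fin m) (Γ.image Prod.snd) x := by
  refine (hΓ.le_span hp a k).trans (Submodule.span_mono ?_)
  rintro y ⟨α, γ, hγ, h1, h2, rfl⟩
  refine ⟨α, ?_, γ.2, Finset.mem_image_of_mem _ hγ, rfl⟩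
  rw [degree_eq_add]
  have := hΓ.fst_ge γ hγ
  have := hΓ.snd_ge γ hγ
  omega

theorem IsGenerators.finite (hΓ : IsGenerators n m p₀ ℳ Γ b) (hp : ∀ t, p t = p₀) (c : ℤ × ℤ) :
    Module.Finite K (ℳ c) := by
  classical
  have h := hΓ.le_growthSpan hp (a := c.1 - p₀ * c.2) (k := c.2)
    (x := (c.1 - p₀ * c.2 + c.2 + 2 * b).toNat) (by omega)
  rw [sub_add_cancel] at h
  have : Module.Finite K (growthSpan K (σ := Fin n ⊕ Fin m) (Γ.image Prod.snd)
    (c.1 - p₀ * c.2 + c.2 + 2 * b).toNat) := Module.Finite.iff_fg.2 (growthSpan_fg _ _)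
  exact Submodule.finiteDimensional_of_le h

/-- The Hilbert function of a bigraded module is given by a rational function. -/
theorem IsGenerators.exists_finrank_eq [Module.Finite (PolyXY K n m) M]
    (hΓ : IsGenerators n m p₀ ℳ Γ b) (hp : ∀ t, p t = p₀) :
    ∃ W c, ∀ a k : ℤ, (Module.finrank K (ℳ (a + p₀ * k, k)) : ℤ) = rationalCoeff W c n m a k := by
  refine exists_eq_rationalCoeff p₀ n m (fun c => (Module.finrank K (ℳ c) : ℤ)) (-b) ?_ ?_
  · intro a k h
    rw [hΓ.eq_bot hp h, finrank_bot, Nat.cast_zero]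
  · have := isRationalFunction_finrank (isGradedBy_bidegree n p ℳ) (hΓ.finite hp)
      ((List.finRange n).map Sum.inl ++ (List.finRange m).map Sum.inr) (by
        rintro (i | i) <;> simp)
    refine (congrArg (IsRationalFunction · _) ?_).mp this
    rw [List.map_append, List.map_map, List.map_map]
    congr 1
    · rw [List.eq_replicate_iff]
      simp [bidegree]
    · rw [List.eq_replicate_iff]
      simp [bidegree, hp]

/-- Elements of `𝔪 ^ s M` have no components of small degree. -/
theorem IsGenerators.proj_eq_zero_of_mem_pow_smul (hΓ : IsGenerators n m p₀ ℳ Γ b)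
    (hp : ∀ t, p t = p₀) (s : ℕ) :
    ∀ x ∈ (idealX K n m ^ s • (⊤ : Submodule (PolyXY K n m) M)), ∀ a k : ℤ, a < s - b →
      proj ℳ (a + p₀ * k, k) x = 0 := by
  have hg := isGradedBy_bidegree n p ℳ
  -- No variable lowers `a`: the `xᵢ` raise it by one and the `yⱼ` leave it fixed. Hence vanishing
  -- below a given `a` is stable under the action of `A`.
  have hsmul : ∀ (s : ℕ) (f : PolyXY K n m) (x : M),
      (∀ a k : ℤ, a < s - b → proj ℳ (a + p₀ * k, k) x = 0) →
      ∀ a k : ℤ, a < s - b → proj ℳ (a + p₀ * k, k) (f • x) = 0 := by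
    intro s f x hx
    induction f using MvPolynomial.induction_on generalizing x with
    | C r => exact fun a k h => by rw [C_smul, map_smul, hx a k h, smul_zero]
    | add f g hf hg =>
      exact fun a k h => by rw [add_smul, map_add, hf x hx a k h, hg x hx a k h, add_zero]
    | mul_X f i hf =>
      rw [mul_smul]
      refine hf _ fun a k h => ?_
      rw [hg.proj_X_smul']
      rcases i with i | i
      · rw [show ((a + p₀ * k, k) : ℤ × ℤ) - bidegree n p (Sum.inl i) =
          ((a - 1) + p₀ * k, k) from Prod.ext (by simp [bidegree]; ring) (by simp [bidegree]),
          hx _ _ (by omega), smul_zero]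
      · rw [show ((a + p₀ * k, k) : ℤ × ℤ) - bidegree n p (Sum.inr i) =
          (a + p₀ * (k - 1), k - 1) from
            Prod.ext (by simp [bidegree, hp]; ring) (by simp [bidegree]),
          hx _ _ h, smul_zero]
  let Z : ℕ → Submodule (PolyXY K n m) M := fun s =>
    { carrier := {x | ∀ a k : ℤ, a < s - b → proj ℳ (a + p₀ * k, k) x = 0}
      add_mem' := fun hx hy a k h => by rw [map_add, hx a k h, hy a k h, add_zero]
      zero_mem' := fun a k _ => map_zero _
      smul_mem' := hsmul s }
  suffices h : idealX K n m ^ s • (⊤ : Submodule (PolyXY K n m) M) ≤ Z s from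
    fun x hx => h hx
  induction s with
  | zero =>
    intro x _ a k h
    have h1 := proj_mem ℳ (a + p₀ * k, k) x
    rw [hΓ.eq_bot hp (Or.inl (by simpa using h))] at h1
    exact (Submodule.mem_bot _).1 h1
  | succ s ih =>
    rw [pow_succ', Submodule.mul_smul]
    refine (Submodule.smul_mono le_rfl ih).trans ?_
    rw [idealX, Submodule.span_smul_eq, Submodule.set_smul_le_iff]
    rintro _ x ⟨i, rfl⟩ hx a k h
    rw [hg.proj_X_smul', show ((a + p₀ * k, k) : ℤ × ℤ) - bidegree n p (Sum.inl i) =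
      ((a - 1) + p₀ * k, k) from Prod.ext (by simp [bidegree]; ring) (by simp [bidegree]),
      hx _ _ (by push_cast at h; omega), smul_zero]

/-- The growth of the sum of the dimensions of the `M_(a + p k, k)` for fixed `a`. -/
theorem IsGenerators.growth_column [Module.Finite (PolyXY K n m) M]
    (hΓ : IsGenerators n m p₀ ℳ Γ b) (hp : ∀ t, p t = p₀) (t₀ a : ℤ) :
    ∃ A : ℕ, ∀ k : ℕ, ∑ l ∈ Finset.Icc t₀ (k : ℤ), Module.finrank K (ℳ (a + p₀ * l, l)) ≤
      A * (k + 1) ^ supportNatDim (PolyXY K n m)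
        (M ⧸ (idealX K n m • (⊤ : Submodule (PolyXY K n m) M))) := by
  classical
  -- This gives `a < s - b`, so `𝔪 ^ s M` has no components in column `a` and that column embeds in
  -- the quotient. The final `+ 1` guarantees `s ≠ 0`, as needed to compare supports.
  set s := (a + b + 1).toNat + 1 with hs
  set Q := M ⧸ (idealX K n m ^ s • (⊤ : Submodule (PolyXY K n m) M)) with hQ
  let π : M →ₗ[PolyXY K n m] Q := Submodule.mkQ _
  obtain ⟨A, hA⟩ := growth_le (K := K) (σ := Fin n ⊕ Fin m) (N := Q)
    ((Γ.image Prod.snd).image π)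
  rw [supportNatDim_quotient_pow _ (by omega)] at hA
  set δ := supportNatDim (PolyXY K n m) (M ⧸ (idealX K n m • (⊤ : Submodule (PolyXY K n m) M)))
  refine ⟨A * (a.toNat + 2 * b + 1) ^ δ, fun k => ?_⟩
  have hinj : Function.Injective fun l : ℤ => (a + p₀ * l, l) := fun l l' h =>
    congrArg Prod.snd h
  have h1 := sum_finrank_le_of_injOn (ℳ := ℳ) (π.restrictScalars K)
    (growthSpan K (σ := Fin n ⊕ Fin m) ((Γ.image Prod.snd).image π) (a.toNat + k + 2 * b))
    (growthSpan_fg _ _) ((Finset.Icc t₀ (k : ℤ)).image fun l => (a + p₀ * l, l)) (by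
      intro c hc x hx
      obtain ⟨l, hl, rfl⟩ := Finset.mem_image.1 hc
      rw [Finset.mem_Icc] at hl
      have hx' := hΓ.le_growthSpan hp (x := a.toNat + k + 2 * b) (by push_cast; omega) hx
      have hx'' := Submodule.mem_map_of_mem (f := π.restrictScalars K) hx'
      rw [growthSpan, Submodule.map_span] at hx''
      refine Submodule.span_mono ?_ hx''
      rintro _ ⟨_, ⟨α, hα, g, hg, rfl⟩, rfl⟩
      exact ⟨α, hα, π g, Finset.mem_image_of_mem _ hg, map_smul π _ _⟩) (by
      intro x hx c hc
      obtain ⟨l, hl, rfl⟩ := Finset.mem_image.1 hc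
      exact hΓ.proj_eq_zero_of_mem_pow_smul hp s x ((Submodule.Quotient.mk_eq_zero _).1 hx) _ _
        (by omega))
  rw [Finset.sum_image hinj.injOn] at h1
  refine h1.trans ((hA _).trans ?_)
  rw [mul_assoc, ← mul_pow]
  gcongr
  nlinarith [Nat.zero_le (a.toNat * k), Nat.zero_le (b * k)]

theorem le_componentSpace (i k : ℤ) : ℳ (i, k) ≤ componentSpace ℳ k :=
  le_iSup (fun i => ℳ (i, k)) i

/-- Finitely many elements generating `M_k` over `S`. -/
theorem IsGenerators.exists_component_generators (hΓ : IsGenerators n m p₀ ℳ Γ b)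
    (hp : ∀ t, p t = p₀) (k : ℤ) :
    ∃ Y : Finset (component (n := n) p ℳ k), ∀ (a : ℤ) (x : ℕ), a + b ≤ x →
      (show Submodule K (RestrictX K n m M) from ℳ (a + p₀ * k, k)) ≤
        (growthSpan K (σ := Fin n) Y x).map ((component (n := n) p ℳ k).subtype.restrictScalars K)
      := by
  classical
  have hfin : {β : Fin m →₀ ℕ | β.degree ≤ (k + b).toNat}.Finite := by
    refine (Set.finite_Iic (Finsupp.equivFunOnFinite.symm fun _ => (k + b).toNat)).subset ?_
    intro α hα i
    exact (Finsupp.le_degree i α).trans hα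
  let Y₀ : Set M := Set.image2 (fun (β : Fin m →₀ ℕ) (g : M) =>
    (MvPolynomial.rename Sum.inr (MvPolynomial.monomial β (1 : K)) : PolyXY K n m) • g)
    {β : Fin m →₀ ℕ | β.degree ≤ (k + b).toNat} (Γ.image Prod.snd : Finset M)
  have hY₀ : Y₀.Finite := hfin.image2 _ (Finset.finite_toSet _)
  -- `Y₀` may contain elements outside `M_k`; only those lying in `M_k` are kept.
  have hY₁ : (Subtype.val ⁻¹' (show Set (RestrictX K n m M) from Y₀) :
      Set (component (n := n) p ℳ k)).Finite := Set.Finite.preimage Subtype.val_injective.injOn hY₀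
  refine ⟨hY₁.toFinset, fun a x hx => ?_⟩
  refine (hΓ.le_span hp a k).trans ?_
  refine (Submodule.span_le (R := K) (M := M)).2 ?_
  rintro _ ⟨α, γ, hγ, h1, h2, rfl⟩
  have h3 := hΓ.fst_ge γ hγ
  have h4 := hΓ.snd_ge γ hγ
  set y : M := (MvPolynomial.rename Sum.inr (MvPolynomial.monomial (exponentY α) (1 : K)) :
    PolyXY K n m) • γ.2 with hy
  have hyk : y ∈ componentSpace ℳ k := by
    have h5 := (isGradedBy_bidegree n p ℳ).monomial_smul_mem
      ((exponentY α).mapDomain Sum.inr) (hΓ.mem γ hγ)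
    rw [hy, MvPolynomial.rename_monomial]
    have h6 : (Finsupp.weight (bidegree n p) ((exponentY α).mapDomain Sum.inr) + γ.1).2 = k := by
      rw [weight_bidegree hp]
      have : exponentY ((exponentY α).mapDomain (Sum.inr : Fin m → Fin n ⊕ Fin m)) =
          exponentY α := Finsupp.comapDomain_mapDomain _ Sum.inr_injective _
      rw [this, Prod.snd_add]
      dsimp only
      omega
    rw [← h6]
    exact le_componentSpace _ _ h5
  refine ⟨(MvPolynomial.monomial (exponentX α) (1 : K) : PolyX K n) •
    (⟨y, hyk⟩ : component (n := n) p ℳ k), ?_, ?_⟩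
  · refine Submodule.subset_span ⟨exponentX α, by omega, _, ?_, rfl⟩
    rw [Set.Finite.mem_toFinset]
    exact Set.mem_image2_of_mem (by rw [Set.mem_ofPred_eq]; omega)
      (Finset.mem_coe.2 (Finset.mem_image_of_mem _ hγ))
  · change inclX K n m (MvPolynomial.monomial (exponentX α) (1 : K)) • y = _
    rw [hy, smul_smul, ← monomial_eq_inclX_mul]

theorem IsGenerators.component_finite (hΓ : IsGenerators n m p₀ ℳ Γ b) (hp : ∀ t, p t = p₀)
    (k : ℤ) : Module.Finite (PolyX K n) (component (n := n) p ℳ k) := by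
  obtain ⟨Y, hY⟩ := hΓ.exists_component_generators hp k
  refine ⟨⟨Y, ?_⟩⟩
  rw [eq_top_iff]
  rintro ⟨x, hx⟩ -
  have h1 : componentSpace ℳ k ≤ (show Submodule K M from
      ((Submodule.span (PolyX K n) (Y : Set (component (n := n) p ℳ k))).restrictScalars K).map
        ((component (n := n) p ℳ k).subtype.restrictScalars K)) := by
    refine iSup_le fun i => ?_
    have h2 := hY (i - p₀ * k) (i - p₀ * k + b).toNat (by omega)
    rw [sub_add_cancel] at h2
    refine h2.trans (Submodule.map_mono ?_)
    refine Submodule.span_le.2 ?_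
    rintro _ ⟨α, _, g, hg, rfl⟩
    exact Submodule.smul_mem _ _ (Submodule.subset_span hg)
  obtain ⟨y, hy, hyx⟩ := h1 hx
  have : y = ⟨x, hx⟩ := Subtype.ext hyx
  rw [← this]
  exact hy

/-- The growth of the sum of the dimensions of the `M_(a + p k, k)` for fixed `k`. -/
theorem IsGenerators.growth_row (hΓ : IsGenerators n m p₀ ℳ Γ b) (hp : ∀ t, p t = p₀) (t₀ k : ℤ) :
    ∃ A : ℕ, ∀ a : ℕ, ∑ l ∈ Finset.Icc t₀ (a : ℤ), Module.finrank K (ℳ (l + p₀ * k, k)) ≤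
      A * (a + 1) ^ natDim K n (component (n := n) p ℳ k) := by
  classical
  obtain ⟨Y, hY⟩ := hΓ.exists_component_generators hp k
  have hfin := hΓ.component_finite hp k
  obtain ⟨A, hA⟩ := growth_le (K := K) (σ := Fin n) Y
  set d := supportNatDim (PolyX K n) (component (n := n) p ℳ k)
  refine ⟨A * (b + 1) ^ d, fun a => ?_⟩
  have hfg := growthSpan_fg (K := K) (σ := Fin n) Y (a + b)
  have : Module.Finite K (growthSpan K (σ := Fin n) Y (a + b)) := Module.Finite.iff_fg.2 hfg
  have hinj : Function.Injective fun l : ℤ => (l + p₀ * k, k) := fun l l' h => by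
    have := congrArg Prod.fst h
    simpa using this
  have h1 := sum_finrank_le_of_injOn (ℳ := ℳ) LinearMap.id
    (show Submodule K M from (growthSpan K (σ := Fin n) Y (a + b)).map
      ((component (n := n) p ℳ k).subtype.restrictScalars K)) (hfg.map _)
    ((Finset.Icc t₀ (a : ℤ)).image fun l => (l + p₀ * k, k)) (by
      intro c hc x hx
      obtain ⟨l, hl, rfl⟩ := Finset.mem_image.1 hc
      rw [Finset.mem_Icc] at hl
      exact hY l (a + b) (by push_cast; omega) hx) (by
      rintro x hx c -
      rw [show x = 0 from hx, map_zero])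
  rw [Finset.sum_image hinj.injOn] at h1
  refine h1.trans ((Submodule.finrank_map_le _ _).trans ((hA _).trans ?_))
  change _ ≤ A * (b + 1) ^ d * (a + 1) ^ d
  rw [mul_assoc, ← mul_pow]
  gcongr
  nlinarith [Nat.zero_le (b * a)]

/-- For `k ≥ b` no generator has second degree `k + 1`, so each spanning monomial multiple in
`M_(k+1)` contains some `yⱼ`. Hence `M_(k+1) = ∑ yⱼ M_k`, and whatever kills `M_k` kills `M_(k+1)`.
-/
theorem IsGenerators.annihilator_le (hΓ : IsGenerators n m p₀ ℳ Γ b) (hp : ∀ t, p t = p₀) {k : ℤ}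
    (hk : b ≤ k) : Module.annihilator (PolyX K n) (component (n := n) p ℳ k) ≤
      Module.annihilator (PolyX K n) (component (n := n) p ℳ (k + 1)) := by
  intro f hf
  rw [Module.mem_annihilator] at hf ⊢
  have hf' : ∀ x ∈ componentSpace ℳ k, inclX K n m f • x = 0 := fun x hx =>
    congrArg Subtype.val (hf ⟨x, hx⟩)
  rintro ⟨x, hx⟩
  refine Subtype.ext ?_
  change inclX K n m f • (show M from x) = 0
  replace hx : (show M from x) ∈ componentSpace ℳ (k + 1) := hx
  have hle : componentSpace ℳ (k + 1) ≤
      LinearMap.ker ((LinearMap.lsmul (PolyXY K n m) M (inclX K n m f)).restrictScalars K) := by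
    refine iSup_le fun i => ?_
    have h2 := hΓ.le_span hp (i - p₀ * (k + 1)) (k + 1)
    rw [sub_add_cancel] at h2
    refine h2.trans (Submodule.span_le.2 ?_)
    rintro _ ⟨α, γ, hγ, -, h1, rfl⟩
    have h3 := hΓ.snd_le γ hγ
    obtain ⟨t, ht⟩ : ∃ t, exponentY α t ≠ 0 := by
      by_contra! h
      have : exponentY α = 0 := by ext i; exact h i
      rw [this] at h1
      simp at h1
      omega
    have ht' : α (Sum.inr t) ≠ 0 := ht
    have h4 : Finsupp.single (Sum.inr t) 1 + (α - Finsupp.single (Sum.inr t) 1) = α :=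
      add_tsub_cancel_of_le (Finsupp.single_le_iff.2 (Nat.one_le_iff_ne_zero.2 ht'))
    have h5 : MvPolynomial.monomial α (1 : K) = MvPolynomial.X (Sum.inr t) *
        MvPolynomial.monomial (α - Finsupp.single (Sum.inr t) 1) 1 := by
      rw [MvPolynomial.X, MvPolynomial.monomial_mul, h4, one_mul]
    have h6 := (isGradedBy_bidegree n p ℳ).monomial_smul_mem
      (α - Finsupp.single (Sum.inr t) 1) (hΓ.mem γ hγ)
    have h7 : (Finsupp.weight (bidegree n p) (α - Finsupp.single (Sum.inr t) 1) + γ.1).2 = k := by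
      have := congrArg (fun α => (Finsupp.weight (bidegree n p) α).2) h4
      simp only [map_add, Prod.snd_add] at this
      rw [Finsupp.weight_single, weight_bidegree hp α] at this
      simp only [bidegree, Sum.elim_inr, one_smul] at this
      rw [Prod.snd_add]
      unfold bidegree
      linarith
    change inclX K n m f • MvPolynomial.monomial α (1 : K) • γ.2 = 0
    rw [h5, mul_smul, smul_comm, hf', smul_zero]
    rw [← h7]
    exact le_componentSpace _ _ h6
  exact hle hx

/-- The dimension of `M_k` is eventually constant. -/
theorem IsGenerators.exists_supportDim_eq_ldim (hΓ : IsGenerators n m p₀ ℳ Γ b)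
    (hp : ∀ t, p t = p₀) : ∃ k₀ : ℤ, ∀ k ≥ k₀,
      Module.supportDim (PolyX K n) (component (n := n) p ℳ k) = ldim (n := n) p ℳ := by
  have hmono : Monotone fun j : ℕ =>
      Module.annihilator (PolyX K n) (component (n := n) p ℳ (b + j)) := by
    refine monotone_nat_of_le_succ fun j => ?_
    have := hΓ.annihilator_le hp (k := b + j) (by omega)
    rwa [add_assoc] at this
  -- The dimension of a finite module depends only on its annihilator, so stabilization of the
  -- annihilators suffices.
  obtain ⟨j₀, hj₀⟩ := monotone_stabilizes_iff_noetherian.2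
    (inferInstance : IsNoetherian (PolyX K n) (PolyX K n)) ⟨_, hmono⟩
  have h : ∀ k ≥ (b : ℤ) + j₀, Module.supportDim (PolyX K n) (component (n := n) p ℳ k) =
      Module.supportDim (PolyX K n) (component (n := n) p ℳ (b + j₀)) := by
    intro k hk
    obtain ⟨j, rfl⟩ : ∃ j : ℕ, k = b + j := ⟨(k - b).toNat, by omega⟩
    have := hΓ.component_finite hp (b + j)
    have := hΓ.component_finite hp (b + j₀)
    rw [Module.supportDim_eq_ringKrullDim_quotient_annihilator,
      Module.supportDim_eq_ringKrullDim_quotient_annihilator]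
    have h1 := hj₀ j (by omega)
    simp only [OrderHom.coe_mk] at h1
    rw [h1]
  refine ⟨b + j₀, fun k hk => ?_⟩
  rw [h k hk, ldim, limsup_congr (eventually_atTop.2 ⟨_, h⟩), limsup_const]

theorem finrank_componentGrading (k i : ℤ) :
    Module.finrank K (componentGrading (n := n) p ℳ k i) = Module.finrank K (ℳ (i, k)) := by
  have hinj : Function.Injective ((component (n := n) p ℳ k).subtype.restrictScalars K) :=
    Subtype.val_injective
  rw [(Submodule.equivMapOfInjective _ hinj (componentGrading (n := n) p ℳ k i)).finrank_eq,
    componentGrading, Submodule.map_comap_eq_self]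
  · rfl
  · rintro x hx
    exact ⟨⟨x, le_componentSpace (M := M) (ℳ := ℳ) i k hx⟩, rfl⟩

/-- Each summation over the degree divides the series by `1 - s`, turning `n` into `n + i`; the
shift by `p₀ * k` passes from the degree `x` to the coordinate `a`. -/
theorem iteratedHilbertFunction_eq {W : Finset (ℤ × ℤ)} {c : ℤ × ℤ → ℤ}
    (h : ∀ a k : ℤ, (Module.finrank K (ℳ (a + p₀ * k, k)) : ℤ) = rationalCoeff W c n m a k)
    (k : ℤ) (i : ℕ) (x : ℤ) :
    iteratedHilbertFunction (componentGrading (n := n) p ℳ k) i x =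
      rationalCoeff W c (n + i) m (x - p₀ * k) k := by
  induction i generalizing x with
  | zero =>
    rw [iteratedHilbertFunction, hilbertFunction, finrank_componentGrading, add_zero, ← h,
      sub_add_cancel]
  | succ i ih =>
    obtain ⟨t₀, ht₀⟩ := exists_rationalCoeff_eq_zero W c
    rw [iteratedHilbertFunction]
    simp only [ih]
    refine finsum_Iic_eq_of_sub (f := fun x => rationalCoeff W c (n + (i + 1)) m (x - p₀ * k) k)
      (t₀ := t₀ + p₀ * k) (fun t ht => ht₀ _ _ _ _ (Or.inl (by linarith))) (fun t => ?_) x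
    rw [sub_right_comm]
    exact rationalCoeff_sub_left W c (n + i) m _ k

end Bigraded

/-! ### Iterated Hilbert coefficients -/

section Coeffs

variable {K : Type*} [Field K] {N : Type*} [AddCommGroup N] [Module K N] {n : ℕ}
  [Module (PolyX K n) N] {𝒩 : ℤ → Submodule K N}

theorem sum_range_reflect_binomPoly (R : ℕ) (e : ℕ → ℚ) :
    ∑ j ∈ Finset.range R, C ((-1 : ℚ) ^ j * e j) * binomPoly (R - 1 - j) =
      ∑ l ∈ Finset.range R, C ((-1 : ℚ) ^ (R - 1 - l) * e (R - 1 - l)) * binomPoly l := by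
  rw [← Finset.sum_range_reflect]
  refine Finset.sum_congr rfl fun j hj => ?_
  rw [Finset.mem_range] at hj
  rw [show R - 1 - (R - 1 - j) = j by omega]

theorem IsIteratedHilbertCoeffs.unique {i : ℕ} {e e' : ℕ → ℤ}
    (h : IsIteratedHilbertCoeffs n 𝒩 i e) (h' : IsIteratedHilbertCoeffs n 𝒩 i e') : e = e' := by
  have h1 := eq_of_eventually_eval_eq (h.1.mp (h'.1.mono fun x hx' hx => hx.symm.trans hx'))
  rw [sum_range_reflect_binomPoly _ fun j => (e j : ℚ),
    sum_range_reflect_binomPoly _ fun j => (e' j : ℚ)] at h1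
  have h2 := coeff_eq_of_sum_binomPoly_eq h1
  funext j
  rcases lt_or_ge j (natDim K n N + i) with hj | hj
  · have h3 := h2 (natDim K n N + i - 1 - j) (by omega)
    rw [show natDim K n N + i - 1 - (natDim K n N + i - 1 - j) = j by omega] at h3
    exact_mod_cast mul_left_cancel₀ (pow_ne_zero j (by norm_num : (-1 : ℚ) ≠ 0)) h3
  · rw [h.2 j hj, h'.2 j hj]

theorem IsIteratedHilbertCoeffs.iteratedHilbertCoeff_eq {i : ℕ} {e : ℕ → ℤ}
    (h : IsIteratedHilbertCoeffs n 𝒩 i e) : iteratedHilbertCoeff n 𝒩 i = e := by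
  funext j
  have hex : ∃ e : ℕ → ℤ, IsIteratedHilbertCoeffs n 𝒩 i e := ⟨e, h⟩
  rw [iteratedHilbertCoeff, dif_pos hex, hex.choose_spec.unique h]

/-- A binomial expansion of the Hilbert polynomial gives the iterated Hilbert coefficients. -/
theorem IsIteratedHilbertPolynomial.exists_coeffs {i : ℕ} {c : ℕ → ℚ}
    (h : IsIteratedHilbertPolynomial 𝒩 i
      (∑ l ∈ Finset.range (natDim K n N + i), C (c l) * binomPoly l)) :
    ∃ e : ℕ → ℤ, IsIteratedHilbertCoeffs n 𝒩 i e ∧ ∀ j < natDim K n N + i,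
      (e j : ℚ) = (-1) ^ j * c (natDim K n N + i - 1 - j) := by
  have hint := integral_of_eventually_integral (h.mono fun x hx => ⟨_, hx.symm⟩)
  choose! z hz using hint
  set R := natDim K n N + i with hR
  have he : ∀ j < R, (((if j < R then (-1) ^ j * z (R - 1 - j) else 0 : ℤ)) : ℚ) =
      (-1) ^ j * c (R - 1 - j) := fun j hj => by
    rw [if_pos hj, hz _ (by omega)]
    push_cast
    rfl
  refine ⟨fun j => if j < R then (-1) ^ j * z (R - 1 - j) else 0, ⟨?_, ?_⟩, he⟩
  · refine (congrArg (IsIteratedHilbertPolynomial 𝒩 i) ?_).mp h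
    rw [← hR, sum_range_reflect_binomPoly R fun j =>
      ((if j < R then (-1) ^ j * z (R - 1 - j) else 0 : ℤ) : ℚ)]
    refine Finset.sum_congr rfl fun l hl => ?_
    rw [Finset.mem_range] at hl
    rw [he _ (by omega), ← mul_assoc, ← mul_pow, show R - 1 - (R - 1 - l) = l by omega]
    norm_num
  · intro j hj
    exact if_neg (by omega)

theorem isIteratedHilbertCoeffs_zero [Subsingleton N] (i : ℕ) :
    IsIteratedHilbertCoeffs n 𝒩 i (fun _ => 0) := by
  have h : ∀ i x, iteratedHilbertFunction 𝒩 i x = 0 := by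
    intro i
    induction i with
    | zero =>
      intro x
      rw [iteratedHilbertFunction, hilbertFunction, Module.finrank_zero_of_subsingleton,
        Nat.cast_zero]
    | succ i ih =>
      intro x
      rw [iteratedHilbertFunction]
      simp [ih]
  refine ⟨Eventually.of_forall fun x => ?_, fun _ _ => rfl⟩
  rw [h]
  simp

end Coeffs

/-- The coefficient of `binomPoly l` in the Hilbert polynomial of `M_k`, as a polynomial in `k`. -/
def shiftedCoeffPoly (W : Finset (ℤ × ℤ)) (c : ℤ × ℤ → ℤ) (p q r R l : ℕ) : ℚ[X] :=
  ∑ l' ∈ Finset.Ico l R, coeffPoly W c q (r - l') *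
    (binomPoly (l' - l)).comp (C (-1) - C (p : ℚ) * X)

/-- Vandermonde with `t = p * k` re-expands the `binomPoly l'` at `x - p * k` in the basis
`binomPoly l` at `x`. The range of `l'` may be changed from `r` to `R`: terms with `l' ≥ r` vanish
since `coeffPoly` of index `0` is zero, those with `l' ≥ R` by `hR`. -/
theorem rationalCoeff_eq_sum_shiftedCoeffPoly {W : Finset (ℤ × ℤ)} {c : ℤ × ℤ → ℤ} {b : ℤ}
    (hb : ∀ w ∈ W, w.1 < b ∧ w.2 < b) (p q r R : ℕ) {k : ℤ} (hk : b ≤ k)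
    (hR : ∀ l ≥ R, (coeffPoly W c q (r - l)).eval (k : ℚ) = 0) {x : ℤ} (hx : b ≤ x - p * k) :
    (rationalCoeff W c r q (x - p * k) k : ℚ) = (∑ l ∈ Finset.range R,
      C ((shiftedCoeffPoly W c p q r R l).eval (k : ℚ)) * binomPoly l).eval (x : ℚ) := by
  have h1 : (rationalCoeff W c r q (x - p * k) k : ℚ) = ∑ l ∈ Finset.range R,
      (binomPoly l).eval ((x - p * k : ℤ) : ℚ) * (coeffPoly W c q (r - l)).eval (k : ℚ) := by
    rw [rationalCoeff_eq_sum c hb r q hx hk]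
    have hr : ∀ l, l ∉ Finset.range r → (binomPoly l).eval ((x - p * k : ℤ) : ℚ) *
        (coeffPoly W c q (r - l)).eval (k : ℚ) = 0 := fun l hl => by
      rw [Finset.mem_range, not_lt] at hl
      rw [Nat.sub_eq_zero_of_le hl, coeffPoly_zero, eval_zero, mul_zero]
    have hR' : ∀ l, l ∉ Finset.range R → (binomPoly l).eval ((x - p * k : ℤ) : ℚ) *
        (coeffPoly W c q (r - l)).eval (k : ℚ) = 0 := fun l hl => by
      rw [Finset.mem_range, not_lt] at hl
      rw [hR l hl, mul_zero]
    rcases le_total r R with h | h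
    · exact Finset.sum_subset (Finset.range_subset_range.2 h) fun l _ hl => hr l hl
    · exact (Finset.sum_subset (Finset.range_subset_range.2 h) fun l _ hl => hR' l hl).symm
  have h2 : ∀ l, (binomPoly l).eval ((x - p * k : ℤ) : ℚ) = ∑ j ∈ Finset.range (l + 1),
      (binomPoly j).eval (x : ℚ) * (binomPoly (l - j)).eval (-1 - (p : ℚ) * k) := by
    intro l
    have := monomialPoly_eval_sub (l + 1) ((p : ℚ) * k) x
    push_cast
    rw [monomialPoly] at this
    rw [this]
    refine Finset.sum_congr rfl fun j hj => ?_
    rw [Finset.mem_range] at hj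
    rw [show l + 1 - j = (l - j) + 1 by omega, monomialPoly]
  rw [h1, eval_finsetSum]
  simp only [h2, shiftedCoeffPoly, eval_mul, eval_C, eval_finsetSum, eval_comp, eval_sub, eval_X,
    Finset.sum_mul]
  rw [Finset.range_eq_Ico]
  simp only [Finset.range_eq_Ico]
  rw [Finset.sum_sigma', Finset.sum_sigma']
  refine Finset.sum_bij' (fun z _ => ⟨z.2, z.1⟩) (fun z _ => ⟨z.2, z.1⟩) ?_ ?_ ?_ ?_ ?_
  · rintro ⟨a, b⟩ h
    simp only [Finset.mem_sigma, Finset.mem_Ico] at h ⊢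
    omega
  · rintro ⟨a, b⟩ h
    simp only [Finset.mem_sigma, Finset.mem_Ico] at h ⊢
    omega
  · intros; rfl
  · intros; rfl
  · rintro ⟨a, b⟩ h
    dsimp only
    ring

/-- Each summand is a polynomial of degree less than `δ` times one of degree at most `l' - l ≤ R - 1
- l`. With `R = d + i` and `l = R - 1 - j` the threshold becomes `δ + j`. -/
theorem coeff_shiftedCoeffPoly_eq_zero {W : Finset (ℤ × ℤ)} {c : ℤ × ℤ → ℤ} {q δ : ℕ}
    (h : ∀ s t, δ ≤ t → (coeffPoly W c q s).coeff t = 0) (p r R l : ℕ) {t : ℕ}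
    (ht : δ + (R - 1 - l) ≤ t) : (shiftedCoeffPoly W c p q r R l).coeff t = 0 := by
  rw [shiftedCoeffPoly, finsetSum_coeff]
  refine Finset.sum_eq_zero fun l' hl' => ?_
  rw [Finset.mem_Ico] at hl'
  rw [coeff_mul]
  refine Finset.sum_eq_zero fun z hz => ?_
  rw [Finset.HasAntidiagonal.mem_antidiagonal] at hz
  rcases lt_or_ge z.1 δ with h1 | h1
  · rw [coeff_eq_zero_of_natDegree_lt (n := z.2), mul_zero]
    refine lt_of_le_of_lt (natDegree_comp_le.trans (Nat.mul_le_mul (natDegree_binomPoly_le _)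
      (?_ : _ ≤ 1))) (by omega)
    compute_degree
  · rw [h _ _ h1, zero_mul]

/-! ### Degree and vanishing of the coefficient polynomials of a bigraded module -/

section Bigraded

variable {K : Type*} [Field K] {n m : ℕ} {p : Fin m → ℕ} {p₀ : ℕ}
  {M : Type*} [AddCommGroup M] [Module K M] [Module (PolyXY K n m) M]
  [IsScalarTower K (PolyXY K n m) M] [Module.Finite (PolyXY K n m) M]
  {ℳ : ℤ × ℤ → Submodule K M} [DirectSum.Decomposition ℳ]
  [SetLike.GradedSMul (bigrading K n p) ℳ] {Γ : Finset ((ℤ × ℤ) × M)} {b : ℕ}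
  {W : Finset (ℤ × ℤ)} {c : ℤ × ℤ → ℤ}

/-- The column estimate is inherited by iterated sums over `a`, since these are finite sums of
columns. Taking `n + s` in place of `n` makes the bound available for every `s`, including `s > n`.
-/
theorem IsGenerators.coeff_coeffPoly_eq_zero (hΓ : IsGenerators n m p₀ ℳ Γ b)
    (hp : ∀ t, p t = p₀)
    (h : ∀ a k : ℤ, (Module.finrank K (ℳ (a + p₀ * k, k)) : ℤ) = rationalCoeff W c n m a k)
    (s : ℕ) {t : ℕ} (ht : supportNatDim (PolyXY K n m)
      (M ⧸ (idealX K n m • (⊤ : Submodule (PolyXY K n m) M))) ≤ t) :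
    (coeffPoly W c m s).coeff t = 0 := by
  set δ := supportNatDim (PolyXY K n m) (M ⧸ (idealX K n m • (⊤ : Submodule (PolyXY K n m) M)))
  obtain ⟨B, hB⟩ := exists_lt_fst_snd W
  obtain ⟨t₀, ht₀⟩ := exists_rationalCoeff_eq_zero W c
  have key : ∀ (i : ℕ) (a : ℤ), ∃ A : ℚ, ∀ k : ℕ,
      |(rationalCoeff W c (n + i) (m + 1) a k : ℚ)| ≤ A * ((k : ℚ) + 1) ^ δ := by
    intro i
    induction i with
    | zero =>
      intro a
      obtain ⟨A, hA⟩ := hΓ.growth_column hp t₀ a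
      refine ⟨A, fun k => ?_⟩
      rw [add_zero, ← sum_Icc_eq_of_sub (t₀ := t₀) (fun t ht => ht₀ n (m + 1) a t (Or.inr ht))
        (rationalCoeff_sub_right W c n m a)]
      simp only [← h]
      rw [abs_of_nonneg (by positivity)]
      exact_mod_cast hA k
    | succ i ih =>
      intro a
      choose A hA using ih
      refine ⟨∑ a' ∈ Finset.Icc t₀ a, A a', fun k => ?_⟩
      rw [← add_assoc, ← sum_Icc_eq_of_sub (t₀ := t₀)
        (f := fun a => rationalCoeff W c (n + i + 1) (m + 1) a k)
        (fun t ht => ht₀ _ _ t _ (Or.inl ht)) (fun a => rationalCoeff_sub_left W c _ _ a k)]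
      push_cast
      rw [Finset.sum_mul]
      exact (Finset.abs_sum_le_sum_abs _ _).trans (Finset.sum_le_sum fun a' _ => hA a' k)
  refine BigradedHilbert.coeff_coeffPoly_eq_zero c hB m δ (n + s) (fun a => ?_)
    (Nat.le_add_left s n) ht
  obtain ⟨A, hA⟩ := key s a
  exact ⟨A, Eventually.of_forall hA⟩

theorem IsGenerators.coeffPoly_eval_eq_zero (hΓ : IsGenerators n m p₀ ℳ Γ b)
    (hp : ∀ t, p t = p₀)
    (h : ∀ a k : ℤ, (Module.finrank K (ℳ (a + p₀ * k, k)) : ℤ) = rationalCoeff W c n m a k)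
    {B : ℤ} (hB : ∀ w ∈ W, w.1 < B ∧ w.2 < B) {k : ℤ} (hk : B ≤ k) (i : ℕ) {l : ℕ}
    (hl : natDim K n (component (n := n) p ℳ k) + i ≤ l) :
    (coeffPoly W c m (n + i - l)).eval (k : ℚ) = 0 := by
  obtain ⟨t₀, ht₀⟩ := exists_rationalCoeff_eq_zero W c
  obtain ⟨A, hA⟩ := hΓ.growth_row hp t₀ k
  rcases lt_or_ge l (i + n) with hln | hln
  -- The row estimate concerns one summation, that is denominator exponent `n + 1`. There the
  -- polynomial of index `n + i - l` multiplies `binomPoly (l + 1 - i)`, and `dim M_k + i ≤ l` means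
  -- `dim M_k < l + 1 - i`.
  · have := BigradedHilbert.coeffPoly_eval_eq_zero c hB (n + 1) m
      (natDim K n (component (n := n) p ℳ k)) hk (A := A) (Eventually.of_forall fun a => ?_)
      (l + 1 - i) (by omega)
    · rwa [show n + 1 - (l + 1 - i) = n + i - l by omega] at this
    · rw [← sum_Icc_eq_of_sub (t₀ := t₀) (f := fun a => rationalCoeff W c (n + 1) m a k)
        (fun t ht => ht₀ _ _ t _ (Or.inl ht)) (fun a => rationalCoeff_sub_left W c _ _ a k)]
      simp only [← h]
      rw [abs_of_nonneg (by positivity)]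
      exact_mod_cast hA a
  · rw [Nat.sub_eq_zero_of_le (by omega), coeffPoly_zero, eval_zero]

end Bigraded

end BigradedHilbert

end

/-! ### The main theorem -/

open BigradedHilbert
theorem theorem2p4 {K : Type*} [Field K] (n m : ℕ) (p : Fin m → ℕ) (p₀ : ℕ)
    (hp : ∀ t, p t = p₀)
    {M : Type*} [AddCommGroup M] [Module K M] [Module (PolyXY K n m) M]
    [IsScalarTower K (PolyXY K n m) M] [Module.Finite (PolyXY K n m) M]
    (ℳ : ℤ × ℤ → Submodule K M) [DirectSum.Decomposition ℳ]
    [SetLike.GradedSMul (bigrading K n p) ℳ] :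
    ∃ k₀ : ℤ,
      -- the limit defining `ldim M` exists, and the coefficients of `M_k` are well defined
      (∀ k ≥ k₀, Module.supportDim (PolyX K n) (component (n := n) p ℳ k) = ldim (n := n) p ℳ) ∧
      (∀ k ≥ k₀, ∀ i : ℕ, IsIteratedHilbertCoeffs n (componentGrading (n := n) p ℳ k) i
        (fun j => iteratedHilbertCoeff n (componentGrading (n := n) p ℳ k) i j)) ∧
      ∀ i j : ℕ,
        (∃ q : ℚ[X],
          (∀ k ≥ k₀, (iteratedHilbertCoeff n (componentGrading (n := n) p ℳ k) i j : ℚ) =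
            q.eval (k : ℚ)) ∧
          -- `deg q ≤ dim M/𝔪M + j - 1`; the zero polynomial satisfies every such bound
          ((j : WithBot ℕ∞) < ldim (n := n) p ℳ + i →
            q = 0 ∨ (q.natDegree : WithBot ℕ∞) + 1 ≤
              Module.supportDim (PolyXY K n m)
                (M ⧸ (idealX K n m • (⊤ : Submodule (PolyXY K n m) M))) + j)) ∧
        (ldim (n := n) p ℳ + i ≤ (j : WithBot ℕ∞) →
          ∀ k ≥ k₀, iteratedHilbertCoeff n (componentGrading (n := n) p ℳ k) i j = 0) := by
  obtain ⟨Γ, b, hΓ⟩ := exists_isGenerators n m p₀ ℳ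
  obtain ⟨W, c, hW⟩ := hΓ.exists_finrank_eq hp
  obtain ⟨B, hB⟩ := exists_lt_fst_snd W
  obtain ⟨k₁, hk₁⟩ := hΓ.exists_supportDim_eq_ldim hp
  -- Beyond `k₁` the dimension is constant; beyond `B` the polynomial expansion in `k` is valid.
  refine ⟨max k₁ B, fun k hk => hk₁ k (le_trans (le_max_left _ _) hk), ?_⟩
  -- If `ldim M = ⊥`, then `M_k = 0` for large `k` and all coefficients vanish.
  rcases supportDim_eq_bot_or_eq_natCast (K := K) (σ := Fin n)
    (N := component (n := n) p ℳ k₁) with hbot | hd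
  · rw [hk₁ k₁ le_rfl] at hbot
    have hzero : ∀ k ≥ max k₁ B, ∀ i, IsIteratedHilbertCoeffs n
        (componentGrading (n := n) p ℳ k) i (fun _ => 0) := by
      intro k hk i
      have h1 := hk₁ k (le_trans (le_max_left _ _) hk)
      rw [hbot, Module.supportDim_eq_bot_iff_subsingleton] at h1
      exact isIteratedHilbertCoeffs_zero i
    refine ⟨fun k hk i => ?_, fun i j => ⟨⟨0, fun k hk => ?_, fun _ => Or.inl rfl⟩,
      fun _ k hk => ?_⟩⟩
    · rw [(hzero k hk i).iteratedHilbertCoeff_eq]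
      exact hzero k hk i
    · rw [(hzero k hk i).iteratedHilbertCoeff_eq]
      simp
    · rw [(hzero k hk i).iteratedHilbertCoeff_eq]
  · rw [hk₁ k₁ le_rfl] at hd
    generalize supportNatDim (PolyX K n) (component (n := n) p ℳ k₁) = d at hd
    have hdk : ∀ k ≥ max k₁ B, natDim K n (component (n := n) p ℳ k) = d := by
      intro k hk
      rw [natDim, hk₁ k (le_trans (le_max_left _ _) hk), hd]
      rfl
    have hpoly : ∀ k ≥ max k₁ B, ∀ i, ∃ e : ℕ → ℤ,
        IsIteratedHilbertCoeffs n (componentGrading (n := n) p ℳ k) i e ∧ ∀ j < d + i,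
        (e j : ℚ) = (-1) ^ j *
          (shiftedCoeffPoly W c p₀ m (n + i) (d + i) (d + i - 1 - j)).eval (k : ℚ) := by
      intro k hk i
      have hBk : B ≤ k := le_trans (le_max_right _ _) hk
      have h1 : IsIteratedHilbertPolynomial (componentGrading (n := n) p ℳ k) i
          (∑ l ∈ Finset.range (natDim K n (component (n := n) p ℳ k) + i),
            C ((shiftedCoeffPoly W c p₀ m (n + i) (d + i) l).eval (k : ℚ)) * binomPoly l) := by
        filter_upwards [eventually_ge_atTop (B + p₀ * k)] with x hx
        rw [iteratedHilbertFunction_eq hW, hdk k hk]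
        refine rationalCoeff_eq_sum_shiftedCoeffPoly hB p₀ m (n + i) (d + i) hBk ?_ (by linarith)
        intro l hl
        exact hΓ.coeffPoly_eval_eq_zero hp hW hB hBk i (by rw [hdk k hk]; exact hl)
      have h2 := h1.exists_coeffs
      rwa [hdk k hk] at h2
    refine ⟨fun k hk i => ?_, fun i j => ⟨?_, fun hj k hk => ?_⟩⟩
    · obtain ⟨e, he, -⟩ := hpoly k hk i
      rw [he.iteratedHilbertCoeff_eq]
      exact he
    · rw [hd]
      rcases lt_or_ge j (d + i) with hj | hj
      · refine ⟨C ((-1) ^ j) * shiftedCoeffPoly W c p₀ m (n + i) (d + i) (d + i - 1 - j),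
          fun k hk => ?_, fun _ => ?_⟩
        · obtain ⟨e, he, he'⟩ := hpoly k hk i
          rw [he.iteratedHilbertCoeff_eq, he' j hj, eval_mul, eval_C]
        · rw [or_iff_not_imp_left]
          intro hq
          set q := C ((-1 : ℚ) ^ j) * shiftedCoeffPoly W c p₀ m (n + i) (d + i) (d + i - 1 - j)
          have hcoeff : ∀ t, supportNatDim (PolyXY K n m)
              (M ⧸ (idealX K n m • (⊤ : Submodule (PolyXY K n m) M))) + j ≤ t →
              q.coeff t = 0 := by
            intro t ht
            rw [coeff_C_mul, coeff_shiftedCoeffPoly_eq_zero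
              (fun s t ht => hΓ.coeff_coeffPoly_eq_zero hp hW s ht) _ _ _ _ (by omega), mul_zero]
          have hlt : q.natDegree < supportNatDim (PolyXY K n m)
              (M ⧸ (idealX K n m • (⊤ : Submodule (PolyXY K n m) M))) + j := by
            by_contra! hle
            exact hq (leadingCoeff_eq_zero.1 (hcoeff _ hle))
          -- If `M = 𝔪 M`, the dimension is `⊥` but its natural-number version is `0`. Then every
          -- coefficient of every `coeffPoly` vanishes, so `q = 0`.
          rcases supportDim_eq_bot_or_eq_natCast (K := K) (σ := Fin n ⊕ Fin m)
            (N := M ⧸ (idealX K n m • (⊤ : Submodule (PolyXY K n m) M))) with h | h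
          · refine absurd ?_ hq
            have hzero : ∀ s, coeffPoly W c m s = 0 := fun s => by
              ext t
              exact hΓ.coeff_coeffPoly_eq_zero hp hW s (by rw [supportNatDim, h]; exact t.zero_le)
            simp [q, shiftedCoeffPoly, hzero]
          · rw [h]
            exact_mod_cast hlt
      · exact ⟨0, fun k hk => by
          obtain ⟨e, he, -⟩ := hpoly k hk i
          rw [he.iteratedHilbertCoeff_eq, he.2 j (by rw [hdk k hk]; exact hj)]
          simp, fun _ => Or.inl rfl⟩
    · rw [hd] at hj
      have hj' : d + i ≤ j := by exact_mod_cast hj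
      obtain ⟨e, he, -⟩ := hpoly k hk i
      rw [he.iteratedHilbertCoeff_eq, he.2 j (by rw [hdk k hk]; exact hj')]
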